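/- Let $n\ge 1$, let $\Omega\subset\mathbb R^n$ be a bounded domain (a non-empty connected open set) with Lipschitz boundary, let $p\in(1,\infty)$, and for $\varepsilon>0$ put $\Omega_\varepsilon=\{x\in\Omega : d(x,\partial\Omega)\le\varepsilon\}$. If $u\in W^{1,p}(\Omega)$, then $u$ has a trace on $\partial\Omega$ in $L^p(\partial\Omega)$ (the limit in $L^p(\partial\Omega)$ of the boundary values of $C^1(\mathbb R^n)$ functions that converge to $u$ in $W^{1,p}(\Omega)$), and, denoting the trace again by $u$, $$\lim_{\varepsilon\to0^+}\frac1\varepsilon\int_{\Omega_\varepsilon}|u|^p\,dx=\int_{\partial\Omega}|u|^p\,dS,$$ where $dS$ is the $(n-1)$-dimensional surface (Hausdorff) measure on $\partial\Omega$. -/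

import Mathlib

open MeasureTheory Filter Topology Set
open scoped ENNReal InnerProductSpace ContDiff

noncomputable section

/-- `Ω` has Lipschitz boundary: near each boundary point there are a unit vector `ν` and a Lipschitz
function `γ` on the hyperplane `ν^⊥` such that, locally, `Ω` is the part of the space lying strictly
above the graph of `γ` in the direction `ν`. -/
def HasLipschitzBoundary {n : ℕ} (Ω : Set (EuclideanSpace ℝ (Fin n))) : Prop :=
  ∀ x ∈ frontier Ω, ∃ ν : EuclideanSpace ℝ (Fin n), ‖ν‖ = 1 ∧
    ∃ γ : (Submodule.span ℝ {ν})ᗮ → ℝ, (∃ K : NNReal, LipschitzWith K γ) ∧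
      ∃ r > 0, ∀ y ∈ Metric.ball x r,
        (y ∈ Ω ↔ γ ((Submodule.span ℝ {ν})ᗮ.orthogonalProjectionOnto y) < ⟪ν, y⟫_ℝ)

/-- `G` is the weak gradient of `u` on the open set `Ω`. -/
def IsWeakGradient {n : ℕ} (Ω : Set (EuclideanSpace ℝ (Fin n)))
    (u : EuclideanSpace ℝ (Fin n) → ℝ)
    (G : EuclideanSpace ℝ (Fin n) → EuclideanSpace ℝ (Fin n)) : Prop :=
  LocallyIntegrableOn u Ω ∧ LocallyIntegrableOn G Ω ∧
    ∀ φ : EuclideanSpace ℝ (Fin n) → ℝ, ContDiff ℝ ∞ φ → HasCompactSupport φ → tsupport φ ⊆ Ω →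
      ∀ w : EuclideanSpace ℝ (Fin n),
        ∫ x in Ω, u x * fderiv ℝ φ x w = -∫ x in Ω, ⟪G x, w⟫_ℝ * φ x

/-- `u ∈ W^{1,p}(Ω)`. -/
def MemSobolevOne {n : ℕ} (Ω : Set (EuclideanSpace ℝ (Fin n))) (p : ℝ≥0∞)
    (u : EuclideanSpace ℝ (Fin n) → ℝ) : Prop :=
  MemLp u p (volume.restrict Ω) ∧
    ∃ G, IsWeakGradient Ω u G ∧ MemLp G p (volume.restrict Ω)

/-- The surface measure on `∂Ω`: the `(n-1)`-dimensional Hausdorff measure, normalized so that in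
dimension `d` it agrees with Lebesgue measure on `ℝ^d`, restricted to the boundary. -/
def surfaceMeasure {n : ℕ} (Ω : Set (EuclideanSpace ℝ (Fin n))) :
    Measure (EuclideanSpace ℝ (Fin n)) :=
  (Measure.euclideanHausdorffMeasure (n - 1)).restrict (frontier Ω)

/-- `g ∈ L^p(∂Ω)` is the trace on `∂Ω` of the Sobolev function `u ∈ W^{1,p}(Ω)`: there are functions
`v k`, continuously differentiable on the whole space, that converge to `u` in the norm of
`W^{1,p}(Ω)` and whose restrictions to `∂Ω` converge to `g` in `L^p(∂Ω)`. -/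
def IsTrace {n : ℕ} (Ω : Set (EuclideanSpace ℝ (Fin n))) (p : ℝ≥0∞)
    (u g : EuclideanSpace ℝ (Fin n) → ℝ) : Prop :=
  MemSobolevOne Ω p u ∧ MemLp g p (surfaceMeasure Ω) ∧
    ∃ G, IsWeakGradient Ω u G ∧ ∃ v : ℕ → EuclideanSpace ℝ (Fin n) → ℝ,
      (∀ k, ContDiff ℝ 1 (v k)) ∧
      Tendsto (fun k => eLpNorm (fun x => v k x - u x) p (volume.restrict Ω)) atTop (𝓝 0) ∧
      Tendsto (fun k => eLpNorm (fun x => gradient (v k) x - G x) p (volume.restrict Ω))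
        atTop (𝓝 0) ∧
      Tendsto (fun k => eLpNorm (fun x => v k x - g x) p (surfaceMeasure Ω)) atTop (𝓝 0)

/-- The strip `Ω_ε` of the points of `Ω` at distance at most `ε` from the boundary. -/
def boundaryStrip {n : ℕ} (Ω : Set (EuclideanSpace ℝ (Fin n))) (ε : ℝ) :
    Set (EuclideanSpace ℝ (Fin n)) :=
  {x ∈ Ω | Metric.infDist x (frontier Ω) ≤ ε}

end

/-! For continuous functions the claim is weak convergence of the measures `(1/ε) dx` on the strips
to surface measure. It is checked in a chart where `Ω` lies above the graph of a Lipschitz function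
`γ`. With `t = γ q + ε s`, the strip integral becomes an integral over `q` of fibre integrals in
`s`. Where `γ` is differentiable (almost everywhere, by Rademacher), the point at height `ε s` above
the graph is, for small `ε`, within `ε` of it when `0 < s < √(1 + |∇γ q|²)` and farther away when
`s` exceeds that root. So the fibre integral tends to the value on the graph times this root, which
is the area density, and dominated convergence applies
(`IsGraphChart.tendsto_lintegral_stripMeasure`). The area formula
`euclideanHausdorffMeasure_graphMap_image` identifies the limit with Hausdorff measure, and a
partition of unity globalizes.

To reach Sobolev functions, the `L^p` norm over `(1/ε) dx` on the strip is bounded by the `W^{1,p}`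
norm uniformly in `ε` for `C¹` functions (`HasLipschitzBoundary.exists_lintegral_stripMeasure_le`).
The value at a strip point is controlled by an integral along a segment pointing into `Ω`; after
Fubini, the factor `ε` is the length that a line in this direction spends in the strip. Letting `ε →
0` gives the trace inequality.

`C¹` functions are dense in `W^{1,p}(Ω)`, by mollification shifted into the domain
(`IsWeakGradient.exists_contDiff_approx`). Completeness of `L^p(∂Ω)` then yields a trace, and the
uniform bound carries the limit from `C¹` functions to `u` (`ENNReal.tendsto_of_uniform_approx`). -/

/-! ### Hausdorff measure of Lipschitz graphs -/

section Graph

variable {F : Type*} [NormedAddCommGroup F] [InnerProductSpace ℝ F]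

/-- The graph parametrization `q ↦ (q, γ q)` with values in the Euclidean product. -/
noncomputable def graphMap (γ : F → ℝ) (q : F) : WithLp 2 (F × ℝ) := WithLp.toLp 2 (q, γ q)

/-- The linear graph map of slope `a`. -/
def linearGraphMap (a : F) : F →ₗ[ℝ] WithLp 2 (F × ℝ) where
  toFun q := WithLp.toLp 2 (q, ⟪a, q⟫_ℝ)
  map_add' x y := by rw [inner_add_right]; rfl
  map_smul' c x := by rw [inner_smul_right]; rfl

/-- The Gram operator is `q ↦ q + ⟪a, q⟫ a`, a rank-one perturbation of the identity with
determinant `1 + ‖a‖²`. -/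
theorem normDet_linearGraphMap [FiniteDimensional ℝ F] (a : F) :
    (linearGraphMap a).normDet = √(1 + ‖a‖ ^ 2) := by
  have h := LinearMap.normDet_sq (linearGraphMap a)
  have hT : (linearGraphMap a).adjoint ∘ₗ linearGraphMap a
      = LinearMap.transvection (innerₗ F a) a := by
    ext q
    refine ext_inner_right ℝ fun z => ?_
    simp [LinearMap.adjoint_inner_left, linearGraphMap, LinearMap.transvection.apply,
      WithLp.prod_inner_apply, inner_add_left, inner_smul_left, mul_comm]
  rw [hT, LinearMap.transvection.det] at h
  simp only [innerₗ_apply_apply, real_inner_self_eq_norm_sq] at h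
  rw [← Real.sqrt_sq (LinearMap.normDet_nonneg (linearGraphMap a))]
  congr 1

omit [InnerProductSpace ℝ F] in
theorem dist_le_dist_graphMap (γ : F → ℝ) (y z : F) :
    dist y z ≤ dist (graphMap γ y) (graphMap γ z) := by
  rw [WithLp.prod_dist_eq_of_L2]
  refine Real.le_sqrt_of_sq_le ?_
  change dist y z ^ 2 ≤ dist y z ^ 2 + dist (γ y) (γ z) ^ 2
  nlinarith [sq_nonneg (dist (γ y) (γ z))]

-- Over the same two base points, the increments of the two graph maps differ by a purely vertical
-- vector.
omit [InnerProductSpace ℝ F] in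
theorem dist_graphMap_le_add (γ η : F → ℝ) (y z : F) :
    dist (graphMap γ y) (graphMap γ z) ≤
      dist (graphMap η y) (graphMap η z) + |(γ y - γ z) - (η y - η z)| := by
  have h : graphMap γ y - graphMap γ z = (graphMap η y - graphMap η z)
      + WithLp.toLp 2 ((0 : F), (γ y - γ z) - (η y - η z)) := by
    apply WithLp.ofLp_injective
    ext <;> simp [graphMap]
  rw [dist_eq_norm, dist_eq_norm, h]
  refine (norm_add_le _ _).trans_eq ?_
  congr 1
  rw [WithLp.prod_norm_eq_of_L2]
  simp [Real.sqrt_sq_eq_abs]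

omit [InnerProductSpace ℝ F] in
theorem LipschitzWith.graphMap {γ : F → ℝ} {K : NNReal} (hγ : LipschitzWith K γ) :
    LipschitzWith (1 + K) (graphMap γ) := by
  refine LipschitzWith.of_dist_le_mul fun y z => ?_
  have h := dist_graphMap_le_add γ (fun _ => 0) y z
  have h2 := hγ.dist_le_mul y z
  rw [Real.dist_eq] at h2
  have h3 : dist (_root_.graphMap (fun _ : F => (0 : ℝ)) y)
      (_root_.graphMap (fun _ : F => (0 : ℝ)) z) = dist y z := by
    rw [WithLp.prod_dist_eq_of_L2]; simp [_root_.graphMap]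
  rw [h3] at h
  simp only [sub_self, sub_zero] at h
  push_cast
  linarith

omit [InnerProductSpace ℝ F] in
/-- If the increments of two functions are `δ`-close on `A`, then the map between their graphs
over `A` increases Hausdorff measure at most by the factor `(1 + δ) ^ d`. -/
theorem euclideanHausdorffMeasure_graphMap_image_le [MeasurableSpace F] [BorelSpace F]
    {γ η : F → ℝ} {A : Set F} {δ : NNReal} (d : ℕ)
    (h : ∀ y ∈ A, ∀ z ∈ A, |(γ y - γ z) - (η y - η z)| ≤ δ * dist y z) :
    Measure.euclideanHausdorffMeasure d (graphMap γ '' A) ≤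
      ((1 + δ : NNReal) : ℝ≥0∞) ^ d * Measure.euclideanHausdorffMeasure d (graphMap η '' A) := by
  -- Graph is sent to graph over the same base point; since distances on a graph dominate base
  -- distances, the vertical error costs only the factor `1 + δ`.
  have hL : LipschitzOnWith (1 + δ) (fun w : WithLp 2 (F × ℝ) => graphMap γ w.fst)
      (graphMap η '' A) := by
    refine LipschitzOnWith.of_dist_le_mul ?_
    rintro _ ⟨y, hy, rfl⟩ _ ⟨z, hz, rfl⟩
    have h1 := dist_graphMap_le_add γ η y z
    have h2 := dist_le_dist_graphMap η y z
    have h3 := h y hy z hz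
    have h4 : (δ : ℝ) * dist y z ≤ δ * dist (graphMap η y) (graphMap η z) := by gcongr
    change dist (graphMap γ y) (graphMap γ z) ≤ _
    push_cast
    linarith
  have h1 := hL.hausdorffMeasure_image_le (d := d) (by positivity)
  rw [image_image] at h1
  have h1' : Measure.hausdorffMeasure (d : ℝ) (graphMap γ '' A) ≤
      ((1 + δ : NNReal) : ℝ≥0∞) ^ d * Measure.hausdorffMeasure (d : ℝ) (graphMap η '' A) := by
    have h2 : (fun x => graphMap γ (graphMap η x).fst) = graphMap γ := rfl
    rw [h2] at h1
    simpa using h1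
  simp_rw [Measure.euclideanHausdorffMeasure_def, Measure.smul_apply,
    ENNReal.smul_def, smul_eq_mul]
  calc _ ≤ _ := mul_le_mul_right h1' _
    _ = _ := by ring

end Graph

/-! ### Area formula for Lipschitz graphs. -/

section Area

variable {F : Type*} [NormedAddCommGroup F] [InnerProductSpace ℝ F] [FiniteDimensional ℝ F]
  [MeasurableSpace F] [BorelSpace F]

/-- The area density `√(1 + |∇γ|²)` of a graph. -/
noncomputable def graphDensity (γ : F → ℝ) (q : F) : ℝ := √(1 + ‖gradient γ q‖ ^ 2)

/-- Turns an additive error in the slope into a multiplicative error in the area density. -/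
theorem sqrt_one_add_sq_le {s t δ : ℝ} (hs : 0 ≤ s) (hδ : 0 ≤ δ) (h : s ≤ t + δ) :
    √(1 + s ^ 2) ≤ (1 + δ) * √(1 + t ^ 2) := by
  have h1 : (1 : ℝ) ≤ √(1 + t ^ 2) := Real.one_le_sqrt.2 (by nlinarith)
  have h2 : t ≤ √(1 + t ^ 2) := Real.le_sqrt_of_sq_le (by nlinarith)
  have h3 : √(1 + t ^ 2) ^ 2 = 1 + t ^ 2 := Real.sq_sqrt (by positivity)
  refine Real.sqrt_le_iff.2 ⟨by positivity, ?_⟩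
  have : s ^ 2 ≤ (t + δ) ^ 2 := by gcongr
  rw [mul_pow, h3]
  nlinarith [mul_nonneg hδ (sq_nonneg (t - 1)), mul_nonneg (sq_nonneg δ) (sq_nonneg t),
    mul_nonneg hδ (sq_nonneg t)]

theorem measurable_gradient (γ : F → ℝ) : Measurable (gradient γ) :=
  (LinearIsometryEquiv.continuous _).measurable.comp (measurable_fderiv ℝ γ)

theorem measurable_graphDensity (γ : F → ℝ) : Measurable (graphDensity γ) := by
  unfold graphDensity
  exact (measurable_const.add ((measurable_gradient γ).norm.pow_const 2)).sqrt

/-- Both quantities are compared with the linear graph of slope `a`, whose measure is known exactly: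
`finrank` factors `1 + δ` come from the Hausdorff measure and one more from the density. -/
theorem graph_measure_bounds_of_close {γ : F → ℝ} {A : Set F} (hA : MeasurableSet A) {δ : NNReal}
    {a : F} (h : ∀ y ∈ A, ∀ z ∈ A, |γ y - γ z - ⟪a, y - z⟫_ℝ| ≤ δ * dist y z)
    (h' : ∀ y ∈ A, ‖gradient γ y - a‖ ≤ δ) :
    Measure.euclideanHausdorffMeasure (Module.finrank ℝ F) (graphMap γ '' A) ≤
        ((1 + δ : NNReal) : ℝ≥0∞) ^ (Module.finrank ℝ F + 1) *
          ∫⁻ q in A, ENNReal.ofReal (graphDensity γ q) ∧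
      ∫⁻ q in A, ENNReal.ofReal (graphDensity γ q) ≤
        ((1 + δ : NNReal) : ℝ≥0∞) ^ (Module.finrank ℝ F + 1) *
          Measure.euclideanHausdorffMeasure (Module.finrank ℝ F) (graphMap γ '' A) := by
  have hlin : Measure.euclideanHausdorffMeasure (Module.finrank ℝ F)
      (graphMap (fun q => ⟪a, q⟫_ℝ) '' A) = ENNReal.ofReal √(1 + ‖a‖ ^ 2) * volume A := by
    rw [← normDet_linearGraphMap,
      ← LinearMap.euclideanHausdorffMeasure_image_eq_normDet_mul_volume]
    rfl
  have hc : ((1 + δ : NNReal) : ℝ≥0∞) = ENNReal.ofReal (1 + δ) := by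
    rw [← ENNReal.ofReal_coe_nnreal]; simp
  have k1 : ENNReal.ofReal √(1 + ‖a‖ ^ 2) * volume A ≤
      ((1 + δ : NNReal) : ℝ≥0∞) * ∫⁻ q in A, ENNReal.ofReal (graphDensity γ q) := by
    rw [← lintegral_const_mul' _ _ ENNReal.coe_ne_top, ← setLIntegral_const]
    refine setLIntegral_mono' hA fun q hq => ?_
    rw [hc, ← ENNReal.ofReal_mul (by positivity)]
    refine ENNReal.ofReal_le_ofReal (sqrt_one_add_sq_le (norm_nonneg _) δ.2 ?_)
    have := norm_sub_norm_le a (gradient γ q)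
    rw [norm_sub_rev] at this
    linarith [h' q hq]
  have k2 : ∫⁻ q in A, ENNReal.ofReal (graphDensity γ q) ≤
      ((1 + δ : NNReal) : ℝ≥0∞) * (ENNReal.ofReal √(1 + ‖a‖ ^ 2) * volume A) := by
    rw [← mul_assoc, ← setLIntegral_const]
    refine setLIntegral_mono' hA fun q hq => ?_
    rw [hc, ← ENNReal.ofReal_mul (by positivity)]
    refine ENNReal.ofReal_le_ofReal (sqrt_one_add_sq_le (norm_nonneg _) δ.2 ?_)
    have := norm_sub_norm_le (gradient γ q) a
    linarith [h' q hq]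
  constructor
  · refine (euclideanHausdorffMeasure_graphMap_image_le (η := fun q => ⟪a, q⟫_ℝ) (δ := δ) _
      fun y hy z hz => ?_).trans ?_
    · rw [← inner_sub_right]; exact h y hy z hz
    · rw [hlin, pow_succ _ (Module.finrank ℝ F), mul_assoc]
      exact mul_le_mul_right k1 _
  · refine k2.trans ?_
    rw [← hlin, pow_succ', mul_assoc]
    refine mul_le_mul_right (euclideanHausdorffMeasure_graphMap_image_le _ fun y hy z hz => ?_) _
    rw [← inner_sub_right, abs_sub_comm]; exact h y hy z hz

/-- Disjointing the cover reduces the inequality to subsets of single pieces, up to a `μ`-null set.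
-/
theorem measure_le_of_countable_cover {α ι : Type*} [MeasurableSpace α] [Countable ι]
    {μ ν : Measure α} {S : ι → Set α} (hS : ∀ i, MeasurableSet (S i)) (hcov : μ (⋃ i, S i)ᶜ = 0)
    (h : ∀ i, ∀ A ⊆ S i, MeasurableSet A → μ A ≤ ν A) : μ ≤ ν := by
  classical
  rcases isEmpty_or_nonempty ι with hι | hι
  · have : μ = 0 := by simpa using hcov
    rw [this]; exact Measure.zero_le _
  obtain ⟨e, he⟩ := exists_surjective_nat ι
  set T : ℕ → Set α := fun n => S (e n)
  have hT : ∀ n, MeasurableSet (T n) := fun n => hS _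
  have hU : ⋃ n, T n = ⋃ i, S i := he.iUnion_comp S
  refine Measure.le_iff.2 fun A hA => ?_
  have hd : ∀ n, MeasurableSet (A ∩ disjointed T n) := fun n =>
    hA.inter (MeasurableSet.disjointed hT n)
  have hdj : Pairwise (Function.onFun Disjoint fun n => A ∩ disjointed T n) := fun i j hij =>
    ((disjoint_disjointed T) hij).mono inter_subset_right inter_subset_right
  calc μ A ≤ μ ((⋃ n, A ∩ disjointed T n) ∪ (⋃ i, S i)ᶜ) := by
        refine measure_mono fun x hx => ?_
        by_cases hxS : x ∈ ⋃ i, S i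
        · left
          rw [← inter_iUnion, iUnion_disjointed, hU]
          exact ⟨hx, hxS⟩
        · exact Or.inr hxS
    _ ≤ μ (⋃ n, A ∩ disjointed T n) + μ (⋃ i, S i)ᶜ := measure_union_le _ _
    _ = ∑' n, μ (A ∩ disjointed T n) := by rw [hcov, add_zero, measure_iUnion hdj hd]
    _ ≤ ∑' n, ν (A ∩ disjointed T n) := by
        refine ENNReal.tsum_le_tsum fun n => h (e n) _ ?_ (hd n)
        exact inter_subset_right.trans (disjointed_subset T n)
    _ = ν (⋃ n, A ∩ disjointed T n) := (measure_iUnion hdj hd).symm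
    _ ≤ ν A := measure_mono (iUnion_subset fun n => inter_subset_left)

/-- A set on which `γ` is uniformly `δ`-close to its linearization of slope `a`. -/
def slopePiece (γ : F → ℝ) (δ : ℝ) (a c : F) (m : ℕ) : Set F :=
  ({y | ∀ z, dist z y < 1 / (m + 1 : ℝ) → |γ z - γ y - ⟪a, z - y⟫_ℝ| ≤ δ * dist z y} ∩
    {y | ‖gradient γ y - a‖ ≤ δ}) ∩ Metric.ball c (1 / (2 * (m + 1 : ℝ)))

theorem measurableSet_slopePiece {γ : F → ℝ} (hγ : Continuous γ) (δ : ℝ) (a c : F) (m : ℕ) :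
    MeasurableSet (slopePiece γ δ a c m) := by
  refine (MeasurableSet.inter ?_ ?_).inter measurableSet_ball
  · refine IsClosed.measurableSet ?_
    -- A failure is witnessed by one `z` with strict inequalities, and the same `z` witnesses it for
    -- all nearby points.
    rw [← isOpen_compl_iff, isOpen_iff_mem_nhds]
    intro y hy
    simp only [mem_compl_iff, mem_ofPred_eq, not_forall, not_le] at hy
    obtain ⟨z, hz, hlt⟩ := hy
    have h1 : ∀ᶠ y' in 𝓝 y, dist z y' < 1 / (m + 1 : ℝ) :=
      (continuous_const.dist continuous_id).continuousAt.eventually_lt continuousAt_const hz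
    have h2 : ∀ᶠ y' in 𝓝 y, δ * dist z y' < |γ z - γ y' - ⟪a, z - y'⟫_ℝ| :=
      ContinuousAt.eventually_lt (by fun_prop) (by fun_prop) hlt
    filter_upwards [h1, h2] with y' h1 h2
    simp only [mem_compl_iff, mem_ofPred_eq, not_forall, not_le]
    exact ⟨z, h1, h2⟩
  · exact measurableSet_le ((measurable_gradient γ).sub_const a).norm measurable_const

-- Slopes and centres range over a dense sequence, so countably many pieces suffice: half of `δ`
-- pays for the differentiability error, half for replacing the gradient by a dense slope.
omit [MeasurableSpace F] [BorelSpace F] in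
theorem mem_slopePiece_of_differentiableAt {γ : F → ℝ} {δ : ℝ} (hδ : 0 < δ) {y : F}
    (hy : DifferentiableAt ℝ γ y) :
    ∃ i j m, y ∈ slopePiece γ δ (TopologicalSpace.denseSeq F i)
      (TopologicalSpace.denseSeq F j) m := by
  have hden := TopologicalSpace.denseRange_denseSeq F
  obtain ⟨i, hi⟩ := hden.exists_dist_lt (gradient γ y) (half_pos hδ)
  set a := TopologicalSpace.denseSeq F i
  have hg := hy.hasGradientAt
  rw [hasGradientAt_iff_isLittleO, Asymptotics.isLittleO_iff] at hg
  obtain ⟨ε, hε, hball⟩ := Metric.eventually_nhds_iff.1 (hg (half_pos hδ))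
  obtain ⟨m, hm⟩ := exists_nat_one_div_lt hε
  obtain ⟨j, hj⟩ := hden.exists_dist_lt y (show (0 : ℝ) < 1 / (2 * (m + 1 : ℝ)) by positivity)
  refine ⟨i, j, m, ⟨fun z hz => ?_, ?_⟩, hj⟩
  · have h1 := hball (hz.trans hm)
    have h2 : |⟪gradient γ y - a, z - y⟫_ℝ| ≤ δ / 2 * dist z y := by
      refine (abs_real_inner_le_norm _ _).trans ?_
      rw [dist_eq_norm z y]
      gcongr
      rw [← dist_eq_norm]; exact hi.le
    rw [Real.norm_eq_abs, ← dist_eq_norm] at h1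
    have : γ z - γ y - ⟪a, z - y⟫_ℝ
        = (γ z - γ y - ⟪gradient γ y, z - y⟫_ℝ) + ⟪gradient γ y - a, z - y⟫_ℝ := by
      rw [inner_sub_left]; ring
    rw [this]
    refine (abs_add_le _ _).trans ?_
    linarith
  · rw [mem_ofPred_eq, ← dist_eq_norm]; linarith

theorem graph_measure_bounds_of_subset_slopePiece {γ : F → ℝ} {δ : NNReal} {a c : F} {m : ℕ}
    {A : Set F} (hAS : A ⊆ slopePiece γ δ a c m) (hA : MeasurableSet A) :
    Measure.euclideanHausdorffMeasure (Module.finrank ℝ F) (graphMap γ '' A) ≤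
        ((1 + δ : NNReal) : ℝ≥0∞) ^ (Module.finrank ℝ F + 1) *
          ∫⁻ q in A, ENNReal.ofReal (graphDensity γ q) ∧
      ∫⁻ q in A, ENNReal.ofReal (graphDensity γ q) ≤
        ((1 + δ : NNReal) : ℝ≥0∞) ^ (Module.finrank ℝ F + 1) *
          Measure.euclideanHausdorffMeasure (Module.finrank ℝ F) (graphMap γ '' A) := by
  refine graph_measure_bounds_of_close hA (a := a) (fun y hy z hz => ?_) fun y hy => (hAS hy).1.2
  refine (hAS hz).1.1 y ?_
  -- The ball in a piece has half the radius of validity of the linearization, so any two of its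
  -- points may be compared.
  have h1 := Metric.mem_ball.1 (hAS hy).2
  have h2 := Metric.mem_ball.1 (hAS hz).2
  have h3 := dist_triangle_right y z c
  have : 1 / (2 * (m + 1 : ℝ)) + 1 / (2 * (m + 1 : ℝ)) = 1 / (m + 1 : ℝ) := by field_simp; norm_num
  linarith

theorem measurableEmbedding_graphMap {γ : F → ℝ} {K : NNReal} (hγ : LipschitzWith K γ) :
    MeasurableEmbedding (graphMap γ) := by
  refine (Topology.IsClosedEmbedding.measurableEmbedding ?_)
  refine AntilipschitzWith.isClosedEmbedding (K := 1) ?_ hγ.graphMap.uniformContinuous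
  refine AntilipschitzWith.of_le_mul_dist fun y z => ?_
  simpa using dist_le_dist_graphMap γ y z

/-- **Area formula for Lipschitz graphs.** -/
theorem euclideanHausdorffMeasure_graphMap_image {γ : F → ℝ} {K : NNReal}
    (hγ : LipschitzWith K γ) {A : Set F} (hA : MeasurableSet A) :
    Measure.euclideanHausdorffMeasure (Module.finrank ℝ F) (graphMap γ '' A) =
      ∫⁻ q in A, ENNReal.ofReal (graphDensity γ q) := by
  set d := Module.finrank ℝ F
  set μ : Measure F := Measure.comap (graphMap γ) (Measure.euclideanHausdorffMeasure d) with hμ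
  set ν : Measure F := volume.withDensity fun q => ENNReal.ofReal (graphDensity γ q) with hν
  have hμA : ∀ A, μ A = Measure.euclideanHausdorffMeasure d (graphMap γ '' A) := fun A =>
    (measurableEmbedding_graphMap hγ).comap_apply _ A
  have hνA : ∀ A, MeasurableSet A → ν A = ∫⁻ q in A, ENNReal.ofReal (graphDensity γ q) :=
    fun A hA => withDensity_apply _ hA
  -- The graph map is Lipschitz, and on `F` Hausdorff measure of full dimension is a nonzero
  -- multiple of volume.
  have hμac : μ ≪ volume := by
    refine Measure.AbsolutelyContinuous.mk fun N _ hN => ?_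
    rw [hμA, Measure.euclideanHausdorffMeasure_def, Measure.smul_apply]
    have h1 := hγ.graphMap.hausdorffMeasure_image_le (d := d) (by positivity) N
    have h2 : Measure.hausdorffMeasure (d : ℝ) N = 0 := by
      rw [← InnerProductSpace.euclideanHausdorffMeasure_eq_volume,
        Measure.euclideanHausdorffMeasure_def, Measure.smul_apply, ENNReal.smul_def, smul_eq_mul,
        mul_eq_zero] at hN
      refine hN.resolve_left ?_
      exact_mod_cast Measure.addHaarScalarFactor_volume_hausdorffMeasure_ne_zero d
    rw [h2, mul_zero, nonpos_iff_eq_zero] at h1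
    rw [h1, smul_zero]
  have hνac : ν ≪ volume := withDensity_absolutelyContinuous _ _
  -- Rademacher: the uncovered points lie among the points of non-differentiability.
  have hcov : ∀ δ : NNReal, 0 < δ → volume (⋃ i : ℕ × ℕ × ℕ, slopePiece γ δ
      (TopologicalSpace.denseSeq F i.1) (TopologicalSpace.denseSeq F i.2.1) i.2.2)ᶜ = 0 := by
    intro δ hδ
    refine measure_mono_null ?_ (ae_iff.1 hγ.ae_differentiableAt)
    intro y hy hd
    obtain ⟨i, j, m, h⟩ := mem_slopePiece_of_differentiableAt (NNReal.coe_pos.2 hδ) hd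
    exact hy (mem_iUnion.2 ⟨(i, j, m), h⟩)
  have hm : ∀ δ : NNReal, ∀ i : ℕ × ℕ × ℕ, MeasurableSet (slopePiece γ δ
      (TopologicalSpace.denseSeq F i.1) (TopologicalSpace.denseSeq F i.2.1) i.2.2) :=
    fun δ i => measurableSet_slopePiece hγ.continuous _ _ _ _
  have key1 : ∀ δ : NNReal, 0 < δ → μ ≤ ((1 + δ : NNReal) : ℝ≥0∞) ^ (d + 1) • ν := by
    intro δ hδ
    refine measure_le_of_countable_cover (hm δ) (hμac (hcov δ hδ)) fun i B hB hBm => ?_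
    rw [hμA, Measure.smul_apply, hνA B hBm, smul_eq_mul]
    exact (graph_measure_bounds_of_subset_slopePiece hB hBm).1
  have key2 : ∀ δ : NNReal, 0 < δ → ν ≤ ((1 + δ : NNReal) : ℝ≥0∞) ^ (d + 1) • μ := by
    intro δ hδ
    refine measure_le_of_countable_cover (hm δ) (hνac (hcov δ hδ)) fun i B hB hBm => ?_
    rw [Measure.smul_apply, hμA, hνA B hBm, smul_eq_mul]
    exact (graph_measure_bounds_of_subset_slopePiece hB hBm).2
  have lim : ∀ c : ℝ≥0∞, Tendsto (fun δ : NNReal => ((1 + δ : NNReal) : ℝ≥0∞) ^ (d + 1) * c)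
      (𝓝[>] 0) (𝓝 c) := by
    intro c
    have h1 : Tendsto (fun δ : NNReal => (((1 + δ) ^ (d + 1) : NNReal) : ℝ≥0∞)) (𝓝[>] 0)
        (𝓝 ((1 : NNReal) : ℝ≥0∞)) := by
      refine ENNReal.tendsto_coe.2 ?_
      have : ContinuousAt (fun δ : NNReal => (1 + δ) ^ (d + 1)) 0 := by fun_prop
      simpa using this.tendsto.mono_left nhdsWithin_le_nhds
    have h2 := ENNReal.Tendsto.mul_const (b := c) h1 (Or.inl (by simp))
    simpa using h2
  rw [← hμA, ← hνA A hA]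
  refine le_antisymm (ge_of_tendsto (lim (ν A)) ?_) (ge_of_tendsto (lim (μ A)) ?_)
  · filter_upwards [self_mem_nhdsWithin] with δ hδ using key1 δ hδ A
  · filter_upwards [self_mem_nhdsWithin] with δ hδ using key2 δ hδ A

/-- Integration over a Lipschitz graph. -/
theorem lintegral_restrict_range_graphMap {γ : F → ℝ} {K : NNReal} (hγ : LipschitzWith K γ)
    {f : WithLp 2 (F × ℝ) → ℝ≥0∞} (hf : Measurable f) :
    ∫⁻ w in range (graphMap γ), f w ∂(Measure.euclideanHausdorffMeasure (Module.finrank ℝ F)) =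
      ∫⁻ q, ENNReal.ofReal (graphDensity γ q) * f (graphMap γ q) := by
  have hE := measurableEmbedding_graphMap hγ
  have : (Measure.euclideanHausdorffMeasure (Module.finrank ℝ F)).restrict (range (graphMap γ))
      = (volume.withDensity fun q => ENNReal.ofReal (graphDensity γ q)).map (graphMap γ) := by
    refine Measure.ext fun B hB => ?_
    rw [Measure.restrict_apply hB, hE.map_apply, withDensity_apply _ (hE.measurable hB),
      ← euclideanHausdorffMeasure_graphMap_image hγ (hE.measurable hB), image_preimage_eq_inter_range]
  rw [this, hE.lintegral_map]
  exact lintegral_withDensity_eq_lintegral_mul _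
    (measurable_graphDensity γ).ennreal_ofReal (hf.comp hE.measurable)

end Area

/-! ### Graph charts at the boundary -/

theorem exists_linearIsometryEquiv_orthogonal_unit {d : ℕ} {ν : EuclideanSpace ℝ (Fin (d + 1))}
    (hν : ‖ν‖ = 1) :
    ∃ (e : EuclideanSpace ℝ (Fin d) ≃ₗᵢ[ℝ] (Submodule.span ℝ {ν})ᗮ)
      (Φ : WithLp 2 (EuclideanSpace ℝ (Fin d) × ℝ) ≃ₗᵢ[ℝ] EuclideanSpace ℝ (Fin (d + 1))),
      ∀ q t, Φ (WithLp.toLp 2 (q, t)) = (e q : EuclideanSpace ℝ (Fin (d + 1))) + t • ν := by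
  have hν0 : ν ≠ 0 := by rintro rfl; simp at hν
  have : Fact (Module.finrank ℝ (EuclideanSpace ℝ (Fin (d + 1))) = d + 1) := ⟨by simp⟩
  have hfr : Module.finrank ℝ (Submodule.span ℝ {ν})ᗮ = d :=
    Submodule.finrank_orthogonal_span_singleton hν0
  let e : EuclideanSpace ℝ (Fin d) ≃ₗᵢ[ℝ] (Submodule.span ℝ {ν})ᗮ :=
    ((stdOrthonormalBasis ℝ (Submodule.span ℝ {ν})ᗮ).reindex (finCongr hfr)).repr.symm
  let L : WithLp 2 (EuclideanSpace ℝ (Fin d) × ℝ) →ₗ[ℝ] EuclideanSpace ℝ (Fin (d + 1)) :=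
    { toFun := fun w => (e w.fst : EuclideanSpace ℝ (Fin (d + 1))) + w.snd • ν
      map_add' := fun x y => by simp [add_smul]; abel
      map_smul' := fun c x => by simp [mul_smul] }
  let LI : WithLp 2 (EuclideanSpace ℝ (Fin d) × ℝ) →ₗᵢ[ℝ] EuclideanSpace ℝ (Fin (d + 1)) :=
    { toLinearMap := L
      norm_map' := fun w => by
        have h0 : ⟪(e w.fst : EuclideanSpace ℝ (Fin (d + 1))), ν⟫_ℝ = 0 :=
          Submodule.inner_left_of_mem_orthogonal (Submodule.mem_span_singleton_self ν) (e w.fst).2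
        have h1 : ‖L w‖ ^ 2 = ‖w‖ ^ 2 := by
          change ‖(e w.fst : EuclideanSpace ℝ (Fin (d + 1))) + w.snd • ν‖ ^ 2 = _
          have h2 : ‖(e w.fst : EuclideanSpace ℝ (Fin (d + 1)))‖ = ‖w.fst‖ := e.norm_map _
          rw [norm_add_sq_real, inner_smul_right, h0, norm_smul, hν, WithLp.prod_norm_sq_eq_of_L2,
            h2]
          simp
        exact (sq_eq_sq₀ (norm_nonneg _) (norm_nonneg _)).1 h1 }
  have hdim : Module.finrank ℝ (WithLp 2 (EuclideanSpace ℝ (Fin d) × ℝ))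
      = Module.finrank ℝ (EuclideanSpace ℝ (Fin (d + 1))) := by
    rw [(WithLp.linearEquiv 2 ℝ (EuclideanSpace ℝ (Fin d) × ℝ)).finrank_eq]
    simp
  exact ⟨e, LI.toLinearIsometryEquiv hdim, fun q t => rfl⟩

/-- `Ω` coincides in the ball `ball x r` with the epigraph of `γ` in the coordinates `Φ`. -/
def IsGraphChart {d : ℕ} (Ω : Set (EuclideanSpace ℝ (Fin (d + 1))))
    (x : EuclideanSpace ℝ (Fin (d + 1)))
    (Φ : WithLp 2 (EuclideanSpace ℝ (Fin d) × ℝ) ≃ₗᵢ[ℝ] EuclideanSpace ℝ (Fin (d + 1)))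
    (γ : EuclideanSpace ℝ (Fin d) → ℝ) (r : ℝ) : Prop :=
  ∀ q t, Φ (WithLp.toLp 2 (q, t)) ∈ Metric.ball x r → (Φ (WithLp.toLp 2 (q, t)) ∈ Ω ↔ γ q < t)

theorem HasLipschitzBoundary.exists_isGraphChart {d : ℕ}
    {Ω : Set (EuclideanSpace ℝ (Fin (d + 1)))} (hΩ : HasLipschitzBoundary Ω)
    {x : EuclideanSpace ℝ (Fin (d + 1))} (hx : x ∈ frontier Ω) :
    ∃ Φ γ r, ∃ K : NNReal, 0 < r ∧ LipschitzWith K γ ∧ IsGraphChart Ω x Φ γ r := by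
  obtain ⟨ν, hν, γ, ⟨K, hγ⟩, r, hr, h⟩ := hΩ x hx
  obtain ⟨e, Φ, hΦ⟩ := exists_linearIsometryEquiv_orthogonal_unit hν
  refine ⟨Φ, γ ∘ e, r, K, hr, ?_, fun q t hqt => ?_⟩
  · simpa using hγ.comp e.lipschitz
  · rw [h _ hqt, hΦ, map_add]
    have h1 : (Submodule.span ℝ {ν})ᗮ.orthogonalProjectionOnto (t • ν) = 0 := by
      rw [Submodule.orthogonalProjectionOnto_eq_zero_iff]
      exact Submodule.le_orthogonal_orthogonal _
        (Submodule.smul_mem _ _ (Submodule.mem_span_singleton_self ν))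
    have h2 : ⟪ν, (e q : EuclideanSpace ℝ (Fin (d + 1)))⟫_ℝ = 0 :=
      Submodule.inner_right_of_mem_orthogonal (Submodule.mem_span_singleton_self ν) (e q).2
    rw [h1, Submodule.orthogonalProjectionOnto_mem_subspace_eq_self, inner_add_right, h2,
      inner_smul_right, real_inner_self_eq_norm_sq, hν]
    simp

namespace IsGraphChart

variable {d : ℕ} {Ω : Set (EuclideanSpace ℝ (Fin (d + 1)))}
  {x : EuclideanSpace ℝ (Fin (d + 1))}
  {Φ : WithLp 2 (EuclideanSpace ℝ (Fin d) × ℝ) ≃ₗᵢ[ℝ] EuclideanSpace ℝ (Fin (d + 1))}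
  {γ : EuclideanSpace ℝ (Fin d) → ℝ} {r : ℝ}

theorem mem_frontier_iff (h : IsGraphChart Ω x Φ γ r) (hΩ : IsOpen Ω) (hγ : Continuous γ)
    {q : EuclideanSpace ℝ (Fin d)} {t : ℝ} (hb : Φ (WithLp.toLp 2 (q, t)) ∈ Metric.ball x r) :
    Φ (WithLp.toLp 2 (q, t)) ∈ frontier Ω ↔ t = γ q := by
  rw [hΩ.frontier_eq, Set.mem_sdiff, h q t hb, not_lt]
  constructor
  · rintro ⟨hcl, hle⟩
    refine le_antisymm hle (not_lt.1 fun hlt => ?_)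
    -- The region strictly below the graph is open and misses `Ω` inside the ball, so its points
    -- there are not in the closure.
    have hU : IsOpen {y | (Φ.symm y).snd < γ (Φ.symm y).fst} := by
      have h1 : Continuous fun y : EuclideanSpace ℝ (Fin (d + 1)) => (Φ.symm y).snd :=
        (WithLp.continuous_snd 2 _ _).comp Φ.symm.continuous
      have h2 : Continuous fun y : EuclideanSpace ℝ (Fin (d + 1)) => (Φ.symm y).fst :=
        (WithLp.continuous_fst 2 _ _).comp Φ.symm.continuous
      exact isOpen_lt h1 (hγ.comp h2)
    obtain ⟨y, ⟨hy1, hy2⟩, hyΩ⟩ := mem_closure_iff.1 hcl _ (hU.inter Metric.isOpen_ball)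
      ⟨by simpa using hlt, hb⟩
    have := h (Φ.symm y).fst (Φ.symm y).snd
    have h3 : Φ (WithLp.toLp 2 ((Φ.symm y).fst, (Φ.symm y).snd)) = y := Φ.apply_symm_apply y
    rw [h3] at this
    exact lt_asymm hy1 ((this hy2).1 hyΩ)
  · rintro rfl
    refine ⟨?_, le_rfl⟩
    have hc : Continuous fun s : ℝ => Φ (WithLp.toLp 2 (q, γ q + s)) :=
      Φ.continuous.comp ((WithLp.prod_continuous_toLp 2 _ _).comp (by fun_prop))
    have h0 : Tendsto (fun s : ℝ => Φ (WithLp.toLp 2 (q, γ q + s))) (𝓝[>] 0)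
        (𝓝 (Φ (WithLp.toLp 2 (q, γ q)))) := by
      have := hc.tendsto 0
      rw [add_zero] at this
      exact this.mono_left nhdsWithin_le_nhds
    refine mem_closure_of_tendsto h0 ?_
    filter_upwards [h0 (Metric.isOpen_ball.mem_nhds hb), self_mem_nhdsWithin] with s hs hs0
    exact (h _ _ hs).2 (by simpa using hs0)

theorem frontier_inter_ball (h : IsGraphChart Ω x Φ γ r) (hΩ : IsOpen Ω) (hγ : Continuous γ) :
    frontier Ω ∩ Metric.ball x r = Φ '' range (graphMap γ) ∩ Metric.ball x r := by
  ext y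
  refine and_congr_left fun hy => ?_
  obtain ⟨w, rfl⟩ := Φ.surjective y
  have := h.mem_frontier_iff hΩ hγ (q := w.fst) (t := w.snd) hy
  change Φ w ∈ frontier Ω ↔ _ at this
  rw [this, Φ.injective.mem_set_image]
  constructor
  · intro h1
    exact ⟨w.fst, by unfold graphMap; rw [← h1]; rfl⟩
  · rintro ⟨q, rfl⟩; rfl

/-- The uniform interior cone property in a graph chart. -/
theorem cone (h : IsGraphChart Ω x Φ γ r) {K : NNReal} (hγ : LipschitzWith K γ)
    {y z : EuclideanSpace ℝ (Fin (d + 1))} {τ : ℝ} (hτ : 0 < τ) (hy : y ∈ Ω)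
    (hyr : y ∈ Metric.ball x (r / 2)) (hτr : 2 * τ ≤ r / 2)
    (hz : dist z (y + τ • Φ (WithLp.toLp 2 (0, 1))) < τ / (1 + K)) : z ∈ Ω := by
  have hK : τ / (1 + K) ≤ τ := div_le_self hτ.le (by linarith [K.2])
  have hK' : τ / (1 + K) * K + τ / (1 + K) = τ := by
    have : (1 + K : ℝ) ≠ 0 := by positivity
    field_simp
    ring
  obtain ⟨v, rfl⟩ := Φ.surjective y
  obtain ⟨w, rfl⟩ := Φ.surjective z
  have hv := (h v.fst v.snd (Metric.ball_subset_ball (by linarith) hyr)).1 hy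
  rw [← map_smul, ← map_add, Φ.dist_map] at hz
  have hn : dist w v < r / 2 := by
    have h1 : dist (v + τ • WithLp.toLp 2 ((0 : EuclideanSpace ℝ (Fin d)), (1 : ℝ))) v = τ := by
      rw [dist_eq_norm, add_sub_cancel_left, norm_smul, WithLp.prod_norm_eq_of_L2]
      simp [abs_of_pos hτ]
    have h2 := dist_triangle w (v + τ • WithLp.toLp 2 ((0 : EuclideanSpace ℝ (Fin d)), (1 : ℝ))) v
    linarith
  have hwr : Φ (WithLp.toLp 2 (w.fst, w.snd)) ∈ Metric.ball x r := by
    have h1 : dist (Φ w) x ≤ dist (Φ w) (Φ v) + dist (Φ v) x := dist_triangle _ _ _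
    rw [Φ.dist_map] at h1
    have h2 := Metric.mem_ball.1 hyr
    exact Metric.mem_ball.2 (by change dist (Φ w) x < r; linarith)
  refine (h w.fst w.snd hwr).2 ?_
  set ρ := dist w (v + τ • WithLp.toLp 2 ((0 : EuclideanSpace ℝ (Fin d)), (1 : ℝ))) with hρ
  have hρ2 : dist w.fst v.fst ^ 2 + (w.snd - (v.snd + τ)) ^ 2 = ρ ^ 2 := by
    rw [hρ, dist_eq_norm w, WithLp.prod_norm_sq_eq_of_L2]
    simp [dist_eq_norm]
  have hρ0 : 0 ≤ ρ := dist_nonneg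
  have h1 : dist w.fst v.fst ≤ ρ := abs_le_of_sq_le_sq' (by nlinarith [sq_nonneg (w.snd - (v.snd + τ))]) hρ0 |>.2
  have h2 : -ρ ≤ w.snd - (v.snd + τ) :=
    abs_le_of_sq_le_sq' (by nlinarith [sq_nonneg (dist w.fst v.fst)]) hρ0 |>.1
  have h3 := hγ.dist_le_mul w.fst v.fst
  rw [Real.dist_eq] at h3
  have h4 := le_abs_self (γ w.fst - γ v.fst)
  have h5 : K * dist w.fst v.fst ≤ τ / (1 + K) * K := by
    rw [mul_comm]
    gcongr
    linarith
  change γ v.fst < v.snd at hv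
  linarith

end IsGraphChart

/-- The uniform interior cone property near `x`. -/
def HasInteriorCone {E : Type*} [NormedAddCommGroup E] [NormedSpace ℝ E] (Ω : Set E) (x : E)
    (r : ℝ) : Prop :=
  ∃ (ν : E) (c τ₀ : ℝ), 0 < c ∧ 0 < τ₀ ∧ ∀ y ∈ Ω ∩ Metric.ball x r, ∀ τ, 0 < τ → τ ≤ τ₀ →
    Metric.ball (y + τ • ν) (c * τ) ⊆ Ω

/-- A ball serves at interior points, the chart's vertical direction at boundary points. -/
theorem HasLipschitzBoundary.exists_hasInteriorCone {d : ℕ}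
    {Ω : Set (EuclideanSpace ℝ (Fin (d + 1)))} (hΩ : HasLipschitzBoundary Ω) (ho : IsOpen Ω)
    {x : EuclideanSpace ℝ (Fin (d + 1))} (hx : x ∈ closure Ω) :
    ∃ r > 0, HasInteriorCone Ω x r := by
  by_cases hxΩ : x ∈ Ω
  · obtain ⟨δ, hδ, hsub⟩ := Metric.isOpen_iff.1 ho x hxΩ
    -- With direction `0` and aperture `1` the cone degenerates to balls around `y`, which stay in
    -- `Ω`.
    refine ⟨δ / 2, by positivity, 0, 1, δ / 2, one_pos, by positivity, fun y hy τ _ hτ' => ?_⟩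
    refine Subset.trans ?_ hsub
    refine Metric.ball_subset_ball' ?_
    have := Metric.mem_ball.1 hy.2
    simp only [smul_zero, add_zero]
    linarith
  · obtain ⟨Φ, γ, r, K, hr, hγ, h⟩ := hΩ.exists_isGraphChart (x := x)
      (by rw [ho.frontier_eq]; exact ⟨hx, hxΩ⟩)
    refine ⟨r / 2, by positivity, Φ (WithLp.toLp 2 (0, 1)), 1 / (1 + K), r / 4, by positivity,
      by positivity, fun y hy τ hτ hτ' z hz => ?_⟩
    refine h.cone hγ hτ hy.1 hy.2 (by linarith) ?_
    rw [Metric.mem_ball] at hz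
    rwa [div_mul_eq_mul_div, one_mul] at hz

/-! ### Points close to a graph -/

section Close

variable {F : Type*} [NormedAddCommGroup F] [InnerProductSpace ℝ F]

omit [InnerProductSpace ℝ F] in
theorem dist_toLp_graphMap_le_iff {γ : F → ℝ} {q q' : F} {t ε : ℝ} (hε : 0 ≤ ε) :
    dist (WithLp.toLp 2 (q, t)) (graphMap γ q') ≤ ε ↔
      ‖q' - q‖ ^ 2 + (t - γ q') ^ 2 ≤ ε ^ 2 := by
  rw [← sq_le_sq₀ dist_nonneg hε, dist_eq_norm, WithLp.prod_norm_sq_eq_of_L2, norm_sub_rev q' q]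
  simp [graphMap]

theorem add_mul_le_sqrt_mul {a u v ε : ℝ} (hε : 0 ≤ ε) (h : u ^ 2 + v ^ 2 ≤ ε ^ 2) :
    v + a * u ≤ √(1 + a ^ 2) * ε := by
  rw [← Real.sqrt_sq hε, ← Real.sqrt_mul (by positivity)]
  refine Real.le_sqrt_of_sq_le ?_
  have : (v + a * u) ^ 2 ≤ (1 + a ^ 2) * (u ^ 2 + v ^ 2) := by nlinarith [sq_nonneg (a * v - u)]
  exact this.trans (by gcongr)

omit [InnerProductSpace ℝ F] in
theorem height_le_of_dist_graphMap_le {γ : F → ℝ} {K : NNReal} (hγ : LipschitzWith K γ) {q q' : F}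
    {s ε : ℝ} (hε : 0 < ε)
    (h : dist (WithLp.toLp 2 (q, γ q + ε * s)) (graphMap γ q') ≤ ε) : s ≤ 1 + K := by
  rw [dist_toLp_graphMap_le_iff hε.le] at h
  have h1 : ‖q' - q‖ ≤ ε :=
    abs_le_of_sq_le_sq' (by nlinarith [sq_nonneg (γ q + ε * s - γ q')]) hε.le |>.2
  have h2 : γ q + ε * s - γ q' ≤ ε :=
    abs_le_of_sq_le_sq' (by nlinarith [sq_nonneg ‖q' - q‖]) hε.le |>.2
  have h3 := hγ.dist_le_mul q' q
  rw [Real.dist_eq, dist_eq_norm] at h3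
  have h4 := le_abs_self (γ q' - γ q)
  have h5 : K * ‖q' - q‖ ≤ K * ε := by gcongr
  have : ε * s ≤ ε * (1 + K) := by linarith
  exact le_of_mul_le_mul_left this hε

variable [CompleteSpace F]

theorem eventually_lt_dist_graphMap {γ : F → ℝ} {q a : F}
    (hq : HasGradientAt γ a q) {s : ℝ} (hs : √(1 + ‖a‖ ^ 2) < s) :
    ∀ᶠ ε in 𝓝[>] (0 : ℝ), ∀ q',
      ε < dist (WithLp.toLp 2 (q, γ q + ε * s)) (graphMap γ q') := by
  set J := √(1 + ‖a‖ ^ 2)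
  -- If some graph point were within `ε`, Cauchy–Schwarz and differentiability with this error would
  -- give `ε s ≤ J ε + (s - J) / 2 * ε`, contradicting `J < s`.
  have hη : 0 < (s - J) / 2 := by linarith
  rw [hasGradientAt_iff_isLittleO, Asymptotics.isLittleO_iff] at hq
  obtain ⟨δ, hδ, hball⟩ := Metric.eventually_nhds_iff.1 (hq hη)
  filter_upwards [Ioo_mem_nhdsGT hδ] with ε hε q'
  by_contra! hle
  rw [dist_toLp_graphMap_le_iff hε.1.le] at hle
  have h1 : ‖q' - q‖ ≤ ε :=
    abs_le_of_sq_le_sq' (by nlinarith [sq_nonneg (γ q + ε * s - γ q')]) hε.1.le |>.2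
  have h2 := hball (by rw [dist_eq_norm]; exact h1.trans_lt hε.2)
  have h3 := le_abs_self (γ q' - γ q - ⟪a, q' - q⟫_ℝ)
  rw [Real.norm_eq_abs] at h2
  have h4 := real_inner_le_norm a (q' - q)
  have h5 := add_mul_le_sqrt_mul (a := ‖a‖) hε.1.le hle
  have h6 : (s - J) / 2 * ‖q' - q‖ ≤ (s - J) / 2 * ε := by gcongr
  have h7 : 0 < (s - J) / 2 * ε := mul_pos hη hε.1
  change _ ≤ J * ε at h5
  linarith

theorem eventually_exists_dist_graphMap_le {γ : F → ℝ} {q a : F}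
    (hq : HasGradientAt γ a q) {s : ℝ} (hs0 : 0 < s) (hs : s < √(1 + ‖a‖ ^ 2)) :
    ∀ᶠ ε in 𝓝[>] (0 : ℝ), ∃ q',
      dist (WithLp.toLp 2 (q, γ q + ε * s)) (graphMap γ q') ≤ ε := by
  have hJ1 : (1 : ℝ) ≤ √(1 + ‖a‖ ^ 2) := Real.one_le_sqrt.2 (by nlinarith [sq_nonneg ‖a‖])
  have hJ2 : √(1 + ‖a‖ ^ 2) ^ 2 = 1 + ‖a‖ ^ 2 := Real.sq_sqrt (by positivity)
  set J := √(1 + ‖a‖ ^ 2)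
  have hJ0 : 0 < J := by linarith
  have haJ : ‖a‖ ≤ J ^ 2 := by rw [hJ2]; nlinarith [sq_nonneg (‖a‖ - 1)]
  -- The point lies at distance `ε s / J` from the tangent plane; this tolerance lets the error `η ε
  -- s` of the tangent plane fill exactly the rest of `ε`.
  set η := (1 - s / J) / s
  have hη : 0 < η := div_pos (by rw [sub_pos, div_lt_one hJ0]; exact hs) hs0
  have hηs : η * s = 1 - s / J := div_mul_cancel₀ _ hs0.ne'
  rw [hasGradientAt_iff_isLittleO, Asymptotics.isLittleO_iff] at hq
  obtain ⟨δ, hδ, hball⟩ := Metric.eventually_nhds_iff.1 (hq hη)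
  filter_upwards [Ioo_mem_nhdsGT (div_pos hδ hs0)] with ε hε
  have hεs : ε * s < δ := (lt_div_iff₀ hs0).1 hε.2
  have hεs0 : 0 < ε * s := mul_pos hε.1 hs0
  -- Horizontal displacement to the foot of the perpendicular on the tangent plane.
  set z : F := (ε * s / J ^ 2) • a with hz
  have hzn : ‖z‖ = ε * s / J ^ 2 * ‖a‖ := by
    rw [hz, norm_smul, Real.norm_of_nonneg (by positivity)]
  have hzle : ‖z‖ ≤ ε * s := by
    rw [hzn, div_mul_eq_mul_div, div_le_iff₀ (by positivity)]
    gcongr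
  have hin : ⟪a, z⟫_ℝ = ε * s / J ^ 2 * ‖a‖ ^ 2 := by
    rw [hz, inner_smul_right, real_inner_self_eq_norm_sq]
  refine ⟨q + z, ?_⟩
  have h2 := hball (y := q + z) (by simpa using hzle.trans_lt hεs)
  rw [add_sub_cancel_left, Real.norm_eq_abs] at h2
  have h3 : dist (WithLp.toLp 2 (q, γ q + ε * s)) (WithLp.toLp 2 (q + z, γ q + ⟪a, z⟫_ℝ))
      ≤ ε * s / J := by
    rw [← sq_le_sq₀ dist_nonneg (by positivity), dist_eq_norm, WithLp.prod_norm_sq_eq_of_L2]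
    change ‖q - (q + z)‖ ^ 2 + ‖γ q + ε * s - (γ q + ⟪a, z⟫_ℝ)‖ ^ 2 ≤ _
    rw [sub_add_cancel_left, norm_neg, add_sub_add_left_eq_sub, Real.norm_eq_abs, sq_abs, hzn, hin]
    have : (ε * s / J ^ 2 * ‖a‖) ^ 2 + (ε * s - ε * s / J ^ 2 * ‖a‖ ^ 2) ^ 2 = (ε * s / J) ^ 2 := by
      have ha : ‖a‖ ^ 2 = J ^ 2 - 1 := by rw [hJ2]; ring
      rw [mul_pow _ ‖a‖, ha]
      field_simp
      ring
    exact this.le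
  have h4 : dist (WithLp.toLp 2 (q + z, γ q + ⟪a, z⟫_ℝ)) (graphMap γ (q + z)) ≤ η * (ε * s) := by
    rw [WithLp.prod_dist_eq_of_L2]
    change √(dist (q + z) (q + z) ^ 2 + dist (γ q + ⟪a, z⟫_ℝ) (γ (q + z)) ^ 2) ≤ _
    rw [dist_self, zero_pow two_ne_zero, zero_add, Real.sqrt_sq dist_nonneg, dist_comm, Real.dist_eq,
      ← sub_sub]
    exact h2.trans (by gcongr)
  refine (dist_triangle _ _ _).trans ((add_le_add h3 h4).trans_eq ?_)
  rw [show η * (ε * s) = ε * (η * s) by ring, hηs]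
  ring

end Close

/-! ### The measure `(1 / ε) dx` on the strip -/

/-- Lebesgue measure on the strip `Ω_ε`, divided by `ε`. -/
noncomputable def stripMeasure {n : ℕ} (Ω : Set (EuclideanSpace ℝ (Fin n))) (ε : ℝ) :
    Measure (EuclideanSpace ℝ (Fin n)) :=
  ENNReal.ofReal (1 / ε) • volume.restrict (boundaryStrip Ω ε)

theorem measurableSet_boundaryStrip {n : ℕ} {Ω : Set (EuclideanSpace ℝ (Fin n))} (ho : IsOpen Ω)
    (ε : ℝ) : MeasurableSet (boundaryStrip Ω ε) :=
  ho.measurableSet.inter (measurableSet_le (Metric.continuous_infDist_pt _).measurable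
    measurable_const)

theorem lintegral_comp_add_mul {ε : ℝ} (hε : 0 < ε) (c : ℝ) {k : ℝ → ℝ≥0∞} (hk : Measurable k) :
    ∫⁻ s, k (c + ε * s) = ENNReal.ofReal (1 / ε) * ∫⁻ t, k t := by
  have h1 : ∫⁻ t, k t = ∫⁻ t, k (c + t) := (lintegral_add_left_eq_self k c).symm
  have hm : Measurable fun t => k (c + t) := hk.comp (measurable_const_add c)
  have h2 := congrArg (fun μ => ∫⁻ t, k (c + t) ∂μ) (Real.smul_map_volume_mul_left hε.ne')
  simp only [lintegral_smul_measure, smul_eq_mul] at h2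
  rw [lintegral_map hm (measurable_const_mul ε), abs_of_pos hε] at h2
  rw [h1, ← h2, ← mul_assoc, ← ENNReal.ofReal_mul (by positivity), one_div,
    inv_mul_cancel₀ hε.ne', ENNReal.ofReal_one, one_mul]

theorem measurePreserving_linearIsometryEquiv_toLp {d : ℕ}
    (Φ : WithLp 2 (EuclideanSpace ℝ (Fin d) × ℝ) ≃ₗᵢ[ℝ] EuclideanSpace ℝ (Fin (d + 1))) :
    MeasurePreserving (fun p : EuclideanSpace ℝ (Fin d) × ℝ => Φ (WithLp.toLp 2 p)) :=
  Φ.measurePreserving.comp (WithLp.volume_preserving_toLp _ _)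

/-- Fubini in the coordinates of `Φ`; rescaling heights above the graph by `ε` absorbs the factor `1
/ ε`. -/
theorem lintegral_stripMeasure_eq {d : ℕ} {Ω : Set (EuclideanSpace ℝ (Fin (d + 1)))}
    (ho : IsOpen Ω)
    (Φ : WithLp 2 (EuclideanSpace ℝ (Fin d) × ℝ) ≃ₗᵢ[ℝ] EuclideanSpace ℝ (Fin (d + 1)))
    (γ : EuclideanSpace ℝ (Fin d) → ℝ)
    {f : EuclideanSpace ℝ (Fin (d + 1)) → ℝ≥0∞} (hf : Measurable f) {ε : ℝ} (hε : 0 < ε) :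
    ∫⁻ y, f y ∂(stripMeasure Ω ε) =
      ∫⁻ q, ∫⁻ s : ℝ, (boundaryStrip Ω ε).indicator f (Φ (WithLp.toLp 2 (q, γ q + ε * s))) := by
  have hm : Measurable ((boundaryStrip Ω ε).indicator f) :=
    hf.indicator (measurableSet_boundaryStrip ho ε)
  have hΦ := measurePreserving_linearIsometryEquiv_toLp Φ
  rw [stripMeasure, lintegral_smul_measure, ← lintegral_indicator (measurableSet_boundaryStrip ho ε),
    ← hΦ.lintegral_comp hm, Measure.volume_eq_prod,
    lintegral_prod (fun p => (boundaryStrip Ω ε).indicator f (Φ (WithLp.toLp 2 p)))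
      (hm.comp hΦ.measurable).aemeasurable, smul_eq_mul,
    ← lintegral_const_mul' _ _ ENNReal.ofReal_ne_top]
  refine lintegral_congr fun q => ?_
  rw [lintegral_comp_add_mul hε (γ q)
    (k := fun t => (boundaryStrip Ω ε).indicator f (Φ (WithLp.toLp 2 (q, t))))]
  exact (hm.comp hΦ.measurable).comp measurable_prodMk_left

/-! ### Convergence of the strip measures in a chart. -/

namespace IsGraphChart

variable {d : ℕ} {Ω : Set (EuclideanSpace ℝ (Fin (d + 1)))}
  {x : EuclideanSpace ℝ (Fin (d + 1))}
  {Φ : WithLp 2 (EuclideanSpace ℝ (Fin d) × ℝ) ≃ₗᵢ[ℝ] EuclideanSpace ℝ (Fin (d + 1))}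
  {γ : EuclideanSpace ℝ (Fin d) → ℝ} {r : ℝ}

/-- Halving the radius keeps every point within `ε`, in particular a nearest boundary point, inside
the chart, where the boundary is the graph. -/
theorem mem_boundaryStrip_iff (h : IsGraphChart Ω x Φ γ r) (ho : IsOpen Ω) (hγ : Continuous γ)
    (hx : x ∈ frontier Ω) {q : EuclideanSpace ℝ (Fin d)} {t ε : ℝ} (hε : ε < r / 2)
    (hy : Φ (WithLp.toLp 2 (q, t)) ∈ Metric.ball x (r / 2)) :
    Φ (WithLp.toLp 2 (q, t)) ∈ boundaryStrip Ω ε ↔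
      γ q < t ∧ ∃ q', dist (WithLp.toLp 2 (q, t)) (graphMap γ q') ≤ ε := by
  have hr : 0 < r / 2 := dist_nonneg.trans_lt (Metric.mem_ball.1 hy)
  have key := h.frontier_inter_ball ho hγ
  have hball : ∀ z, dist (Φ (WithLp.toLp 2 (q, t))) z ≤ ε → z ∈ Metric.ball x r := by
    intro z hz
    have h1 := dist_triangle_left z x (Φ (WithLp.toLp 2 (q, t)))
    have h2 := Metric.mem_ball.1 hy
    exact Metric.mem_ball.2 (by linarith)
  have h0 := h q t (Metric.ball_subset_ball (by linarith) hy)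
  constructor
  · rintro ⟨h1, h2⟩
    refine ⟨h0.1 h1, ?_⟩
    obtain ⟨z, hz, hdz⟩ := isClosed_frontier.exists_infDist_eq_dist ⟨x, hx⟩
      (Φ (WithLp.toLp 2 (q, t)))
    rw [hdz] at h2
    obtain ⟨⟨_, ⟨q', rfl⟩, rfl⟩, -⟩ := key.subset ⟨hz, hball z h2⟩
    exact ⟨q', by rwa [Φ.dist_map] at h2⟩
  · rintro ⟨h1, q', h2⟩
    rw [← Φ.dist_map] at h2
    exact ⟨h0.2 h1, (Metric.infDist_le_dist_of_mem
      (key.symm.subset ⟨⟨_, ⟨q', rfl⟩, rfl⟩, hball _ h2⟩).1).trans h2⟩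

/-- Rescaled heights in the strip fill the interval from `0` to the area density in the limit; the
Lipschitz constant confines them to `[0, 1 + K]`, which gives a dominating function. -/
theorem tendsto_lintegral_fiber (h : IsGraphChart Ω x Φ γ r) (ho : IsOpen Ω) {K : NNReal}
    (hγ : LipschitzWith K γ) (hx : x ∈ frontier Ω) (hr : 0 < r)
    {f : EuclideanSpace ℝ (Fin (d + 1)) → ℝ} (hf : Continuous f)
    (hfs : ∀ y, y ∉ Metric.ball x (r / 2) → f y = 0) {M : ℝ} (hM : ∀ y, f y ≤ M)
    {q : EuclideanSpace ℝ (Fin d)} (hq : DifferentiableAt ℝ γ q) :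
    Tendsto (fun ε : ℝ => ∫⁻ s : ℝ, (boundaryStrip Ω ε).indicator (fun y => ENNReal.ofReal (f y))
        (Φ (WithLp.toLp 2 (q, γ q + ε * s)))) (𝓝[>] 0)
      (𝓝 (ENNReal.ofReal (graphDensity γ q) * ENNReal.ofReal (f (Φ (graphMap γ q))))) := by
  have hΦ := measurePreserving_linearIsometryEquiv_toLp Φ
  have hlimit : ∫⁻ s, (Ioo 0 (graphDensity γ q)).indicator
      (fun _ => ENNReal.ofReal (f (Φ (graphMap γ q)))) s =
      ENNReal.ofReal (graphDensity γ q) * ENNReal.ofReal (f (Φ (graphMap γ q))) := by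
    rw [lintegral_indicator measurableSet_Ioo, setLIntegral_const, Real.volume_Ioo, sub_zero,
      mul_comm]
  rw [← hlimit]
  have hsmall : ∀ᶠ ε in 𝓝[>] (0 : ℝ), 0 < ε ∧ ε < r / 2 := Ioo_mem_nhdsGT (by positivity)
  refine tendsto_lintegral_filter_of_dominated_convergence
    ((Icc 0 (1 + K : ℝ)).indicator fun _ => ENNReal.ofReal M) ?_ ?_ ?_ ?_
  · refine Eventually.of_forall fun ε => ?_
    exact ((hf.measurable.ennreal_ofReal.indicator (measurableSet_boundaryStrip ho ε)).comp
      hΦ.measurable).comp (measurable_prodMk_left.comp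
        (measurable_const.add (measurable_const_mul ε)))
  · filter_upwards [hsmall] with ε hε
    refine Eventually.of_forall fun s => ?_
    by_cases hs : s ∈ Icc 0 (1 + K : ℝ)
    · rw [indicator_of_mem hs]
      exact (indicator_le_self _ _ _).trans (ENNReal.ofReal_le_ofReal (hM _))
    · rw [indicator_of_notMem hs, nonpos_iff_eq_zero, indicator_apply_eq_zero]
      intro hmem
      by_cases hb : Φ (WithLp.toLp 2 (q, γ q + ε * s)) ∈ Metric.ball x (r / 2)
      · obtain ⟨h1, q', h2⟩ := (h.mem_boundaryStrip_iff ho hγ.continuous hx hε.2 hb).1 hmem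
        refine absurd ⟨?_, height_le_of_dist_graphMap_le hγ hε.1 h2⟩ hs
        exact (pos_of_mul_pos_right (by linarith : 0 < ε * s) hε.1.le).le
      · rw [hfs _ hb, ENNReal.ofReal_zero]
  · rw [lintegral_indicator measurableSet_Icc, setLIntegral_const, Real.volume_Icc]
    exact ENNReal.mul_ne_top ENNReal.ofReal_ne_top ENNReal.ofReal_ne_top
  · have hne : ∀ᵐ s : ℝ, s ≠ 0 ∧ s ≠ graphDensity γ q := by
      have h1 : ∀ c : ℝ, ∀ᵐ s : ℝ, s ≠ c := fun c => by
        simp [ae_iff, measure_singleton]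
      filter_upwards [h1 0, h1 (graphDensity γ q)] with s a b using ⟨a, b⟩
    filter_upwards [hne] with s hs
    have hc : Continuous fun ε : ℝ => ENNReal.ofReal (f (Φ (WithLp.toLp 2 (q, γ q + ε * s)))) :=
      ENNReal.continuous_ofReal.comp (hf.comp
        (Φ.continuous.comp ((WithLp.prod_continuous_toLp 2 _ _).comp (by fun_prop))))
    have hc0 : Tendsto (fun ε : ℝ => ENNReal.ofReal (f (Φ (WithLp.toLp 2 (q, γ q + ε * s)))))
        (𝓝[>] 0) (𝓝 (ENNReal.ofReal (f (Φ (graphMap γ q))))) := by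
      have := hc.tendsto 0
      rw [zero_mul, add_zero] at this
      exact this.mono_left nhdsWithin_le_nhds
    by_cases hsI : s ∈ Ioo 0 (graphDensity γ q)
    · rw [indicator_of_mem hsI]
      refine hc0.congr' ?_
      filter_upwards [hsmall, eventually_exists_dist_graphMap_le hq.hasGradientAt hsI.1 hsI.2]
        with ε hε hex
      by_cases hb : Φ (WithLp.toLp 2 (q, γ q + ε * s)) ∈ Metric.ball x (r / 2)
      · rw [indicator_of_mem]
        refine (h.mem_boundaryStrip_iff ho hγ.continuous hx hε.2 hb).2 ⟨?_, hex⟩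
        linarith [mul_pos hε.1 hsI.1]
      · classical rw [indicator_apply, hfs _ hb]; simp
    · rw [indicator_of_notMem hsI]
      refine tendsto_const_nhds.congr' ?_
      have hev : ∀ᶠ ε in 𝓝[>] (0 : ℝ), s < 0 ∨ ∀ q',
          ε < dist (WithLp.toLp 2 (q, γ q + ε * s)) (graphMap γ q') := by
        rcases lt_or_gt_of_ne hs.1 with h1 | h1
        · exact Eventually.of_forall fun _ => Or.inl h1
        · have h2 : graphDensity γ q < s :=
            lt_of_le_of_ne (not_lt.1 fun h2 => hsI ⟨h1, h2⟩) hs.2.symm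
          filter_upwards [eventually_lt_dist_graphMap hq.hasGradientAt h2] with ε hε
          exact Or.inr hε
      filter_upwards [hsmall, hev] with ε hε hev
      symm
      rw [indicator_apply_eq_zero]
      intro hmem
      by_cases hb : Φ (WithLp.toLp 2 (q, γ q + ε * s)) ∈ Metric.ball x (r / 2)
      · obtain ⟨h1, q', h2⟩ := (h.mem_boundaryStrip_iff ho hγ.continuous hx hε.2 hb).1 hmem
        rcases hev with h3 | h3
        · exact absurd h1 (by linarith [mul_neg_of_pos_of_neg hε.1 h3])
        · exact absurd h2 (not_le.2 (h3 q'))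
      · rw [hfs _ hb, ENNReal.ofReal_zero]

theorem lintegral_surfaceMeasure (h : IsGraphChart Ω x Φ γ r) (ho : IsOpen Ω) {K : NNReal}
    (hγ : LipschitzWith K γ) {f : EuclideanSpace ℝ (Fin (d + 1)) → ℝ≥0∞} (hf : Measurable f)
    (hfs : ∀ y, y ∉ Metric.ball x r → f y = 0) :
    ∫⁻ y, f y ∂(surfaceMeasure Ω) =
      ∫⁻ q, ENNReal.ofReal (graphDensity γ q) * f (Φ (graphMap γ q)) := by
  have hind : f = (Metric.ball x r).indicator f := by
    ext y
    by_cases hy : y ∈ Metric.ball x r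
    · rw [indicator_of_mem hy]
    · rw [indicator_of_notMem hy, hfs y hy]
  have hΦ := Φ.toIsometryEquiv.measurePreserving_euclideanHausdorffMeasure d
  have h1 := hΦ.setLIntegral_comp_emb Φ.toHomeomorph.measurableEmbedding f (range (graphMap γ))
  have h2 := lintegral_restrict_range_graphMap hγ (f := fun w => f (Φ w))
    (hf.comp Φ.continuous.measurable)
  rw [finrank_euclideanSpace_fin] at h2
  rw [← h2]
  refine Eq.trans ?_ h1.symm
  change ∫⁻ y in frontier Ω, f y ∂(Measure.euclideanHausdorffMeasure (d + 1 - 1))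
    = ∫⁻ y in Φ '' range (graphMap γ), f y ∂(Measure.euclideanHausdorffMeasure d)
  rw [Nat.add_sub_cancel, hind, lintegral_indicator measurableSet_ball,
    lintegral_indicator measurableSet_ball, Measure.restrict_restrict measurableSet_ball,
    Measure.restrict_restrict measurableSet_ball, inter_comm,
    h.frontier_inter_ball ho hγ.continuous, inter_comm]

theorem tendsto_lintegral_stripMeasure (h : IsGraphChart Ω x Φ γ r) (ho : IsOpen Ω) {K : NNReal}
    (hγ : LipschitzWith K γ) (hx : x ∈ frontier Ω) (hr : 0 < r)
    {f : EuclideanSpace ℝ (Fin (d + 1)) → ℝ} (hf : Continuous f)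
    (hfs : ∀ y, y ∉ Metric.ball x (r / 2) → f y = 0) :
    Tendsto (fun ε : ℝ => ∫⁻ y, ENNReal.ofReal (f y) ∂(stripMeasure Ω ε)) (𝓝[>] 0)
      (𝓝 (∫⁻ y, ENNReal.ofReal (f y) ∂(surfaceMeasure Ω))) := by
  have hΦ := measurePreserving_linearIsometryEquiv_toLp Φ
  obtain ⟨M, hM⟩ : ∃ M, ∀ y, f y ≤ M := by
    obtain ⟨M, hM⟩ := (isCompact_closedBall x (r / 2)).bddAbove_image hf.continuousOn
    refine ⟨max M 0, fun y => ?_⟩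
    by_cases hy : y ∈ Metric.ball x (r / 2)
    · exact (hM ⟨y, Metric.ball_subset_closedBall hy, rfl⟩).trans (le_max_left _ _)
    · rw [hfs y hy]; exact le_max_right _ _
  rw [h.lintegral_surfaceMeasure ho hγ hf.measurable.ennreal_ofReal
    (fun y hy => by rw [hfs y fun h' => hy (Metric.ball_subset_ball (by linarith) h')]; simp)]
  have hsmall : ∀ᶠ ε in 𝓝[>] (0 : ℝ), 0 < ε ∧ ε < r / 2 := Ioo_mem_nhdsGT (by positivity)
  refine Tendsto.congr' (hsmall.mono fun ε hε =>
    (lintegral_stripMeasure_eq ho Φ γ hf.measurable.ennreal_ofReal hε.1).symm) ?_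
  -- `Φ` is a linear isometry, so the base points below the support of `f` have norm less than `R`.
  set R := ‖x‖ + r
  refine tendsto_lintegral_filter_of_dominated_convergence
    ((Metric.closedBall (0 : EuclideanSpace ℝ (Fin d)) R).indicator fun _ =>
      ENNReal.ofReal M * ENNReal.ofReal (1 + K)) ?_ ?_ ?_ ?_
  · refine Eventually.of_forall fun ε => ?_
    refine Measurable.lintegral_prod_right'
      (f := fun p : EuclideanSpace ℝ (Fin d) × ℝ => (boundaryStrip Ω ε).indicator
        (fun y => ENNReal.ofReal (f y)) (Φ (WithLp.toLp 2 (p.1, γ p.1 + ε * p.2)))) ?_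
    refine ((hf.measurable.ennreal_ofReal.indicator (measurableSet_boundaryStrip ho ε)).comp
      hΦ.measurable).comp ?_
    exact measurable_fst.prodMk ((hγ.continuous.measurable.comp measurable_fst).add
      (measurable_snd.const_mul ε))
  · filter_upwards [hsmall] with ε hε
    refine Eventually.of_forall fun q => ?_
    have hpt : ∀ s : ℝ, (boundaryStrip Ω ε).indicator (fun y => ENNReal.ofReal (f y))
        (Φ (WithLp.toLp 2 (q, γ q + ε * s))) ≠ 0 →
        q ∈ Metric.closedBall (0 : EuclideanSpace ℝ (Fin d)) R ∧ s ∈ Icc 0 (1 + K : ℝ) := by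
      intro s hs
      have hmem := mem_of_indicator_ne_zero hs
      have hb : Φ (WithLp.toLp 2 (q, γ q + ε * s)) ∈ Metric.ball x (r / 2) := by
        by_contra hb
        rw [indicator_of_mem hmem, hfs _ hb] at hs
        simp at hs
      obtain ⟨h1, q', h2⟩ := (h.mem_boundaryStrip_iff ho hγ.continuous hx hε.2 hb).1 hmem
      refine ⟨?_, (pos_of_mul_pos_right (by linarith : 0 < ε * s) hε.1.le).le,
        height_le_of_dist_graphMap_le hγ hε.1 h2⟩
      rw [mem_closedBall_zero_iff]
      have h3 : ‖q‖ ≤ ‖WithLp.toLp 2 (q, γ q + ε * s)‖ := WithLp.norm_fst_le _ (WithLp.toLp 2 (q, γ q + ε * s))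
      have h4 : ‖Φ (WithLp.toLp 2 (q, γ q + ε * s))‖ ≤ ‖x‖ + r / 2 := by
        have := norm_le_norm_add_norm_sub' (Φ (WithLp.toLp 2 (q, γ q + ε * s))) x
        rw [← dist_eq_norm] at this
        linarith [Metric.mem_ball.1 hb]
      rw [Φ.norm_map] at h4
      linarith
    by_cases hq : q ∈ Metric.closedBall (0 : EuclideanSpace ℝ (Fin d)) R
    · rw [indicator_of_mem hq]
      calc _ ≤ ∫⁻ s : ℝ, (Icc 0 (1 + K : ℝ)).indicator (fun _ => ENNReal.ofReal M) s := by
            refine lintegral_mono fun s => ?_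
            by_cases hs : s ∈ Icc 0 (1 + K : ℝ)
            · rw [indicator_of_mem hs]
              exact (indicator_le_self _ _ _).trans (ENNReal.ofReal_le_ofReal (hM _))
            · rw [indicator_of_notMem hs]
              exact (not_not.1 fun h0 => hs (hpt s h0).2).le
        _ = _ := by
            rw [lintegral_indicator measurableSet_Icc, setLIntegral_const, Real.volume_Icc, sub_zero]
    · rw [indicator_of_notMem hq, nonpos_iff_eq_zero]
      simp_rw [not_not.1 fun h0 => hq (hpt _ h0).1]
      simp
  · rw [lintegral_indicator measurableSet_closedBall, setLIntegral_const]
    exact ENNReal.mul_ne_top (ENNReal.mul_ne_top ENNReal.ofReal_ne_top ENNReal.ofReal_ne_top)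
      measure_closedBall_lt_top.ne
  · filter_upwards [hγ.ae_differentiableAt] with q hq
    exact h.tendsto_lintegral_fiber ho hγ hx hr hf hfs hM hq

end IsGraphChart

/-- Near an interior point the support of `f` keeps away from the boundary: the surface integral
vanishes and so do the strip integrals for small `ε`. -/
theorem HasLipschitzBoundary.exists_tendsto_lintegral_stripMeasure {d : ℕ}
    {Ω : Set (EuclideanSpace ℝ (Fin (d + 1)))} (hΩ : HasLipschitzBoundary Ω) (ho : IsOpen Ω)
    (hne : (frontier Ω).Nonempty) {x : EuclideanSpace ℝ (Fin (d + 1))} (hx : x ∈ closure Ω) :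
    ∃ r > 0, ∀ f : EuclideanSpace ℝ (Fin (d + 1)) → ℝ, Continuous f →
      (∀ y, y ∉ Metric.ball x r → f y = 0) →
      Tendsto (fun ε : ℝ => ∫⁻ y, ENNReal.ofReal (f y) ∂(stripMeasure Ω ε)) (𝓝[>] 0)
        (𝓝 (∫⁻ y, ENNReal.ofReal (f y) ∂(surfaceMeasure Ω))) := by
  by_cases hxΩ : x ∈ Ω
  · obtain ⟨δ, hδ, hsub⟩ := Metric.isOpen_iff.1 ho x hxΩ
    refine ⟨δ / 2, by positivity, fun f hf hfs => ?_⟩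
    have hfr : ∀ z ∈ frontier Ω, z ∉ Metric.ball x δ := fun z hz hzb => by
      rw [ho.frontier_eq] at hz
      exact hz.2 (hsub hzb)
    have h0 : ∫⁻ y, ENNReal.ofReal (f y) ∂(surfaceMeasure Ω) = 0 := by
      rw [surfaceMeasure, setLIntegral_congr_fun isClosed_frontier.measurableSet (g := fun _ => 0)]
      · simp
      · intro z hz
        dsimp only
        rw [hfs z fun h => hfr z hz (Metric.ball_subset_ball (by linarith) h), ENNReal.ofReal_zero]
    rw [h0]
    refine tendsto_const_nhds.congr' ?_
    filter_upwards [Ioo_mem_nhdsGT (show 0 < δ / 2 by positivity)] with ε hε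
    symm
    rw [stripMeasure, lintegral_smul_measure,
      setLIntegral_congr_fun (measurableSet_boundaryStrip ho ε) (g := fun _ => 0)]
    · simp
    · intro y hy
      dsimp only
      rw [hfs y, ENNReal.ofReal_zero]
      intro hyb
      obtain ⟨z, hz, hdz⟩ := isClosed_frontier.exists_infDist_eq_dist hne y
      refine hfr z hz (Metric.mem_ball.2 ?_)
      have h1 := dist_triangle_left z x y
      have h2 := Metric.mem_ball.1 hyb
      have h3 : dist y z ≤ ε := hdz ▸ hy.2
      linarith [hε.2]
  · have hxf : x ∈ frontier Ω := by rw [ho.frontier_eq]; exact ⟨hx, hxΩ⟩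
    obtain ⟨Φ, γ, r, K, hr, hγ, h⟩ := hΩ.exists_isGraphChart hxf
    exact ⟨r / 2, by positivity, fun f hf hfs =>
      h.tendsto_lintegral_stripMeasure ho hγ hxf hr hf hfs⟩

/-! ### A uniform bound for the strip integrals -/

theorem mul_le_integral_add_of_hasDerivAt {g g' : ℝ → ℝ} {h : ℝ} (hh : 0 ≤ h)
    (hg : ∀ s, HasDerivAt g (g' s) s) (hg' : Continuous g') :
    h * g 0 ≤ ∫ s in (0 : ℝ)..h, (|g s| + h * |g' s|) := by
  have hgc : Continuous g := continuous_iff_continuousAt.2 fun s => (hg s).continuousAt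
  -- The weight `s - h` vanishes at `h`, so only the value at `0` survives; on `[0, h]` it is at
  -- most `h` in absolute value.
  have hd : ∀ s ∈ uIcc 0 h, HasDerivAt (fun s => (s - h) * g s) (1 * g s + (s - h) * g' s) s :=
    fun s _ => ((hasDerivAt_id s).sub_const h).mul (hg s)
  have hi := intervalIntegral.integral_eq_sub_of_hasDerivAt hd
    (Continuous.intervalIntegrable (by fun_prop) _ _)
  have h0 : h * g 0 = ∫ s in (0 : ℝ)..h, (1 * g s + (s - h) * g' s) := by rw [hi]; ring
  rw [h0]
  refine intervalIntegral.integral_mono_on hh (Continuous.intervalIntegrable (by fun_prop) _ _)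
    (Continuous.intervalIntegrable (by fun_prop) _ _) fun s hs => ?_
  have h1 := le_abs_self (g s)
  have h2 : (s - h) * g' s ≤ h * |g' s| := by
    refine (le_abs_self _).trans ?_
    rw [abs_mul]
    gcongr
    rw [abs_le]; constructor <;> linarith [hs.1, hs.2]
  linarith

/-- The energy density `|w|^p + |∇w|^p`. -/
noncomputable def energyDensity {n : ℕ} (p : ℝ) (w : EuclideanSpace ℝ (Fin n) → ℝ)
    (z : EuclideanSpace ℝ (Fin n)) : ℝ :=
  |w z| ^ p + ‖gradient w z‖ ^ p

/-! ### Estimate along a segment. -/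

section

variable {n : ℕ} {p : ℝ} {w : EuclideanSpace ℝ (Fin n) → ℝ}

theorem energyDensity_nonneg (z : EuclideanSpace ℝ (Fin n)) : 0 ≤ energyDensity p w z := by
  unfold energyDensity; positivity

theorem ContDiff.continuous_gradient (hw : ContDiff ℝ 1 w) : Continuous (gradient w) :=
  (LinearIsometryEquiv.continuous _).comp (hw.continuous_fderiv one_ne_zero)

theorem continuous_energyDensity (hp : 1 < p) (hw : ContDiff ℝ 1 w) :
    Continuous (energyDensity p w) :=
  (hw.continuous.abs.rpow_const fun _ => Or.inr (by linarith)).add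
    (hw.continuous_gradient.norm.rpow_const fun _ => Or.inr (by linarith))

theorem mul_rpow_sub_one_le {s t : ℝ} (hp : 1 < p) (hs : 0 ≤ s) (ht : 0 ≤ t) :
    s ^ (p - 1) * t ≤ s ^ p + t ^ p := by
  have hm : 0 ≤ max s t := hs.trans (le_max_left _ _)
  calc s ^ (p - 1) * t ≤ max s t ^ (p - 1) * max s t := by
        exact mul_le_mul (Real.rpow_le_rpow hs (le_max_left _ _) (by linarith)) (le_max_right _ _)
          ht (by positivity)
    _ = max s t ^ p := by
        rw [← Real.rpow_add_one' hm (by linarith), sub_add_cancel]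
    _ ≤ s ^ p + t ^ p := by
        rcases max_choice s t with h | h <;> rw [h]
        · linarith [Real.rpow_nonneg ht p]
        · linarith [Real.rpow_nonneg hs p]

theorem rpow_le_integral_along_segment (hp : 1 < p) (hw : ContDiff ℝ 1 w)
    (y ν : EuclideanSpace ℝ (Fin n)) {h : ℝ} (hh : 0 ≤ h) :
    h * |w y| ^ p ≤ ∫ s in (0 : ℝ)..h, (1 + h * (p * ‖ν‖)) * energyDensity p w (y + s • ν) := by
  have hline : ∀ s : ℝ, HasDerivAt (fun s : ℝ => y + s • ν) ν s := fun s => by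
    simpa using ((hasDerivAt_id s).smul_const ν).const_add y
  have hlc : Continuous fun s : ℝ => y + s • ν := by fun_prop
  have hd : ∀ s : ℝ, HasDerivAt (fun s : ℝ => |w (y + s • ν)| ^ p)
      (p * |w (y + s • ν)| ^ (p - 2) * w (y + s • ν) * ⟪gradient w (y + s • ν), ν⟫_ℝ) s := by
    intro s
    have h1 := (hasDerivAt_abs_rpow (w (y + s • ν)) hp)
    have h2 : HasDerivAt (fun s : ℝ => w (y + s • ν)) ⟪gradient w (y + s • ν), ν⟫_ℝ s := by
      have := ((hw.differentiable one_ne_zero) (y + s • ν)).hasGradientAt.hasFDerivAt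
      simpa [Function.comp_def] using this.comp_hasDerivAt s (hline s)
    exact h1.comp s h2
  -- For `p < 2` the factor `|x| ^ (p - 2)` is singular at `0`; continuity of the product follows
  -- because it is the derivative of the `C¹` function `|x| ^ p`.
  have hcont : Continuous fun x : ℝ => p * |x| ^ (p - 2) * x := by
    have h1 := (contDiff_norm_rpow (E := ℝ) hp).continuous_deriv le_rfl
    convert h1 using 1
    ext x
    simp only [Real.norm_eq_abs]
    exact (hasDerivAt_abs_rpow x hp).deriv.symm
  have hc' : Continuous fun s : ℝ =>
      p * |w (y + s • ν)| ^ (p - 2) * w (y + s • ν) * ⟪gradient w (y + s • ν), ν⟫_ℝ :=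
    (hcont.comp (hw.continuous.comp hlc)).mul
      ((hw.continuous_gradient.comp hlc).inner continuous_const)
  have key := mul_le_integral_add_of_hasDerivAt hh hd hc'
  simp only [zero_smul, add_zero] at key
  refine key.trans ?_
  have hEc := (continuous_energyDensity hp hw).comp hlc
  refine intervalIntegral.integral_mono_on hh (Continuous.intervalIntegrable ?_ _ _)
    (Continuous.intervalIntegrable (continuous_const.mul hEc) _ _) fun s _ => ?_
  · exact (((hw.continuous.comp hlc).abs.rpow_const fun _ => Or.inr (by linarith)).abs).add
      (continuous_const.mul hc'.abs)
  · set z := y + s • ν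
    have h1 : |(|w z| ^ p)| ≤ energyDensity p w z := by
      rw [abs_of_nonneg (by positivity)]
      exact le_add_of_nonneg_right (by positivity)
    have h2 : |p * |w z| ^ (p - 2) * w z * ⟪gradient w z, ν⟫_ℝ|
        ≤ (p * ‖ν‖) * energyDensity p w z := by
      have h3 : |w z| ^ (p - 2) * |w z| = |w z| ^ (p - 1) := by
        rw [← Real.rpow_add_one' (abs_nonneg _) (by linarith)]
        ring_nf
      calc _ = p * (|w z| ^ (p - 2) * |w z|) * |⟪gradient w z, ν⟫_ℝ| := by
            rw [abs_mul, abs_mul, abs_mul, abs_of_pos (by linarith : 0 < p),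
              abs_of_nonneg (by positivity : 0 ≤ |w z| ^ (p - 2))]
            ring
        _ ≤ p * |w z| ^ (p - 1) * (‖gradient w z‖ * ‖ν‖) := by
            rw [h3]
            gcongr
            exact abs_real_inner_le_norm _ _
        _ = (p * ‖ν‖) * (|w z| ^ (p - 1) * ‖gradient w z‖) := by ring
        _ ≤ _ := by
            gcongr
            exact mul_rpow_sub_one_le hp (abs_nonneg _) (norm_nonneg _)
    have h4 : h * |p * |w z| ^ (p - 2) * w z * ⟪gradient w z, ν⟫_ℝ|
        ≤ h * ((p * ‖ν‖) * energyDensity p w z) := by gcongr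
    linarith

end

/-! ### Fubini over lines in the cone direction. -/

section

variable {n : ℕ} {Ω : Set (EuclideanSpace ℝ (Fin n))}

/-- In a region with interior cones in direction `ν`, a line in direction `ν` meets the strip `Ω_ε`
in a set of length `O(ε)`. -/
theorem volume_line_inter_strip_le (ho : IsOpen Ω) (hne : (frontier Ω).Nonempty)
    {x ν : EuclideanSpace ℝ (Fin n)} {r c τ₀ : ℝ} (hc : 0 < c)
    (hcone : ∀ y ∈ Ω ∩ Metric.ball x r, ∀ τ, 0 < τ → τ ≤ τ₀ →
      Metric.ball (y + τ • ν) (c * τ) ⊆ Ω) {ε : ℝ} (z : EuclideanSpace ℝ (Fin n)) :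
    volume {s ∈ Icc 0 τ₀ | z - s • ν ∈ boundaryStrip Ω ε ∩ Metric.ball x r}
      ≤ ENNReal.ofReal (ε / c) := by
  refine (Real.volume_le_diam _).trans (Metric.ediam_le ?_)
  -- Moving from `z - s' • ν` by `(s' - s) • ν` reaches `z - s • ν` with a ball of radius `c (s' -
  -- s)` inside `Ω`; a strip point admits this only if `c (s' - s) ≤ ε`.
  have key : ∀ s s', s ∈ Icc 0 τ₀ → z - s • ν ∈ boundaryStrip Ω ε → s' ∈ Icc 0 τ₀ →
      z - s' • ν ∈ boundaryStrip Ω ε ∩ Metric.ball x r → s < s' → s' - s ≤ ε / c := by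
    intro s s' hs hz hs' hz' hlt
    rw [le_div_iff₀ hc, mul_comm]
    refine le_trans ?_ hz.2
    have h1 := hcone (z - s' • ν) ⟨hz'.1.1, hz'.2⟩ (s' - s) (by linarith) (by linarith [hs.1, hs'.2])
    have h2 : z - s' • ν + (s' - s) • ν = z - s • ν := by rw [sub_smul]; abel
    rw [h2] at h1
    refine (Metric.le_infDist hne).2 fun b hb => ?_
    by_contra! hlt'
    rw [ho.frontier_eq] at hb
    exact hb.2 (h1 (by rwa [Metric.mem_ball, dist_comm]))
  rintro s ⟨hs, hz⟩ s' ⟨hs', hz'⟩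
  rw [edist_dist, Real.dist_eq]
  refine ENNReal.ofReal_le_ofReal ?_
  rcases lt_trichotomy s s' with h | h | h
  · rw [abs_sub_comm, abs_of_pos (by linarith)]; exact key s s' hs hz.1 hs' hz' h
  · have hε : 0 ≤ ε := Metric.infDist_nonneg.trans hz.1.2
    rw [h, sub_self, abs_zero]; positivity
  · rw [abs_of_pos (by linarith)]; exact key s' s hs' hz'.1 hs hz h

theorem HasInteriorCone.exists_lintegral_strip_le (ho : IsOpen Ω) (hne : (frontier Ω).Nonempty)
    {x : EuclideanSpace ℝ (Fin n)} {r : ℝ} (hcone : HasInteriorCone Ω x r) {p : ℝ} (hp : 1 < p) :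
    ∃ C : NNReal, ∀ w : EuclideanSpace ℝ (Fin n) → ℝ, ContDiff ℝ 1 w → ∀ ε > 0,
      ∫⁻ y in boundaryStrip Ω ε ∩ Metric.ball x r, ENNReal.ofReal (|w y| ^ p) ≤
        C * ENNReal.ofReal ε * ∫⁻ z in Ω, ENNReal.ofReal (energyDensity p w z) := by
  obtain ⟨ν, c, τ₀, hc, hτ₀, hcone⟩ := hcone
  set A : ℝ := 1 + τ₀ * (p * ‖ν‖) with hA
  have hA0 : 0 ≤ A := by positivity
  -- `A` is the factor from the segment estimate, `ε / c` the length of a line in the strip, and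
  -- `τ₀` the length of the segment, divided out at the end.
  refine ⟨(A / (τ₀ * c)).toNNReal, fun w hw ε hε => ?_⟩
  set S := boundaryStrip Ω ε ∩ Metric.ball x r with hS
  have hSm : MeasurableSet S := (measurableSet_boundaryStrip ho ε).inter measurableSet_ball
  set e : EuclideanSpace ℝ (Fin n) → ℝ≥0∞ := Ω.indicator fun z => ENNReal.ofReal (energyDensity p w z)
    with he
  have hem : Measurable e := (continuous_energyDensity hp hw).measurable.ennreal_ofReal.indicator
    ho.measurableSet
  -- The whole segment stays in `Ω` by the cone property, so extending the energy by zero outside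
  -- `Ω` loses nothing.
  have hpt : ∀ y ∈ S, ENNReal.ofReal τ₀ * ENNReal.ofReal (|w y| ^ p) ≤
      ∫⁻ s in Icc 0 τ₀, ENNReal.ofReal A * e (y + s • ν) := by
    intro y hy
    rw [← ENNReal.ofReal_mul hτ₀.le]
    refine (ENNReal.ofReal_le_ofReal (rpow_le_integral_along_segment hp hw y ν hτ₀.le)).trans ?_
    have hlc : Continuous fun s : ℝ => y + s • ν := by fun_prop
    have hEc := (continuous_energyDensity hp hw).comp hlc
    rw [intervalIntegral.integral_of_le hτ₀.le, ← integral_Icc_eq_integral_Ioc,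
      ofReal_integral_eq_lintegral_ofReal]
    · refine setLIntegral_mono' measurableSet_Icc fun s hs => ?_
      rw [ENNReal.ofReal_mul hA0]
      gcongr
      rw [he, indicator_of_mem]
      rcases hs.1.eq_or_lt with h0 | h0
      · rw [← h0, zero_smul, add_zero]; exact hy.1.1
      · exact hcone y ⟨hy.1.1, hy.2⟩ s h0 hs.2 (Metric.mem_ball_self (by positivity))
    · exact (continuous_const.mul hEc).continuousOn.integrableOn_Icc
    · exact Eventually.of_forall fun s => mul_nonneg hA0 (energyDensity_nonneg _)
  have hjm : Measurable fun q : EuclideanSpace ℝ (Fin n) × ℝ =>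
      S.indicator (fun _ => (1 : ℝ≥0∞)) (q.1 - q.2 • ν) * (ENNReal.ofReal A * e q.1) :=
    ((measurable_const.indicator hSm).comp (by fun_prop)).mul
      ((hem.comp measurable_fst).const_mul _)
  have main : ENNReal.ofReal τ₀ * ∫⁻ y in S, ENNReal.ofReal (|w y| ^ p) ≤
      ENNReal.ofReal A * ENNReal.ofReal (ε / c) * ∫⁻ z in Ω, ENNReal.ofReal (energyDensity p w z) := by
    calc ENNReal.ofReal τ₀ * ∫⁻ y in S, ENNReal.ofReal (|w y| ^ p)
        = ∫⁻ y in S, ENNReal.ofReal τ₀ * ENNReal.ofReal (|w y| ^ p) :=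
          (lintegral_const_mul' _ _ ENNReal.ofReal_ne_top).symm
      _ ≤ ∫⁻ y in S, ∫⁻ s in Icc 0 τ₀, ENNReal.ofReal A * e (y + s • ν) :=
          setLIntegral_mono' hSm hpt
      _ = ∫⁻ y, ∫⁻ s in Icc 0 τ₀, S.indicator (fun _ => (1 : ℝ≥0∞)) y *
            (ENNReal.ofReal A * e (y + s • ν)) := by
          rw [← lintegral_indicator hSm]
          refine lintegral_congr fun y => ?_
          by_cases hy : y ∈ S <;> simp [hy]
      _ = ∫⁻ s in Icc 0 τ₀, ∫⁻ y, S.indicator (fun _ => (1 : ℝ≥0∞)) y *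
            (ENNReal.ofReal A * e (y + s • ν)) := by
          refine lintegral_lintegral_swap (Measurable.aemeasurable ?_)
          exact ((measurable_const.indicator hSm).comp measurable_fst).mul
            ((hem.comp (by fun_prop)).const_mul _)
      _ = ∫⁻ s in Icc 0 τ₀, ∫⁻ z, S.indicator (fun _ => (1 : ℝ≥0∞)) (z - s • ν) *
            (ENNReal.ofReal A * e z) := by
          refine lintegral_congr fun s => ?_
          rw [← lintegral_add_right_eq_self (fun z => S.indicator (fun _ => (1 : ℝ≥0∞)) (z - s • ν) *
            (ENNReal.ofReal A * e z)) (s • ν)]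
          simp
      _ = ∫⁻ z, ∫⁻ s in Icc 0 τ₀, S.indicator (fun _ => (1 : ℝ≥0∞)) (z - s • ν) *
            (ENNReal.ofReal A * e z) :=
          (lintegral_lintegral_swap hjm.aemeasurable).symm
      _ ≤ ∫⁻ z, ENNReal.ofReal (ε / c) * (ENNReal.ofReal A * e z) := by
          refine lintegral_mono fun z => ?_
          have hsm : Measurable fun s : ℝ => S.indicator (fun _ => (1 : ℝ≥0∞)) (z - s • ν) :=
            (measurable_const.indicator hSm).comp (by fun_prop)
          rw [lintegral_mul_const _ hsm]
          gcongr
          refine le_trans (le_of_eq ?_) (volume_line_inter_strip_le ho hne hc hcone (ε := ε) z)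
          have hT : MeasurableSet {s : ℝ | z - s • ν ∈ S} :=
            hSm.preimage (by fun_prop : Measurable fun s : ℝ => z - s • ν)
          have : (fun s : ℝ => S.indicator (fun _ => (1 : ℝ≥0∞)) (z - s • ν))
              = {s : ℝ | z - s • ν ∈ S}.indicator fun _ => 1 := rfl
          rw [this, lintegral_indicator hT, setLIntegral_one, Measure.restrict_apply hT, inter_comm]
          rfl
      _ = _ := by
          rw [lintegral_const_mul' _ _ ENNReal.ofReal_ne_top,
            lintegral_const_mul' _ _ ENNReal.ofReal_ne_top, he,
            lintegral_indicator ho.measurableSet]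
          ring
  have hτ' : ENNReal.ofReal τ₀ ≠ 0 := by simpa using hτ₀
  rw [← ENNReal.mul_le_mul_iff_right hτ' ENNReal.ofReal_ne_top]
  refine main.trans (le_of_eq ?_)
  change _ = ENNReal.ofReal τ₀ * (ENNReal.ofReal (A / (τ₀ * c)) * ENNReal.ofReal ε * _)
  rw [← ENNReal.ofReal_mul hA0, ← ENNReal.ofReal_mul (by positivity), ← mul_assoc,
    ← ENNReal.ofReal_mul hτ₀.le]
  congr 2
  field_simp

end

/-- Finitely many cone neighbourhoods cover the compact closure; the factor `ε` in each local bound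
cancels the normalization `1 / ε`. -/
theorem HasLipschitzBoundary.exists_lintegral_stripMeasure_le {d : ℕ}
    {Ω : Set (EuclideanSpace ℝ (Fin (d + 1)))} (hΩ : HasLipschitzBoundary Ω) (ho : IsOpen Ω)
    (hb : Bornology.IsBounded Ω) (hne : (frontier Ω).Nonempty) {p : ℝ} (hp : 1 < p) :
    ∃ C : NNReal, ∀ w : EuclideanSpace ℝ (Fin (d + 1)) → ℝ, ContDiff ℝ 1 w → ∀ ε > 0,
      ∫⁻ y, ENNReal.ofReal (|w y| ^ p) ∂(stripMeasure Ω ε) ≤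
        C * ∫⁻ z in Ω, ENNReal.ofReal (energyDensity p w z) := by
  have hloc : ∀ x ∈ closure Ω, ∃ r > 0, ∃ C : NNReal,
      ∀ w : EuclideanSpace ℝ (Fin (d + 1)) → ℝ, ContDiff ℝ 1 w → ∀ ε > 0,
      ∫⁻ y in boundaryStrip Ω ε ∩ Metric.ball x r, ENNReal.ofReal (|w y| ^ p) ≤
        C * ENNReal.ofReal ε * ∫⁻ z in Ω, ENNReal.ofReal (energyDensity p w z) := by
    intro x hx
    obtain ⟨r, hr, hcone⟩ := hΩ.exists_hasInteriorCone ho hx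
    exact ⟨r, hr, hcone.exists_lintegral_strip_le ho hne hp⟩
  choose! r hr C hC using hloc
  obtain ⟨t, hts, htc⟩ := hb.isCompact_closure.elim_nhds_subcover (fun x => Metric.ball x (r x))
    fun x hx => Metric.ball_mem_nhds x (hr x hx)
  refine ⟨∑ x ∈ t, C x, fun w hw ε hε => ?_⟩
  set I := ∫⁻ z in Ω, ENNReal.ofReal (energyDensity p w z)
  have hcov : boundaryStrip Ω ε ⊆ ⋃ x ∈ t, boundaryStrip Ω ε ∩ Metric.ball x (r x) := by
    intro y hy
    obtain ⟨x, hx, hyx⟩ := mem_iUnion₂.1 (htc (subset_closure hy.1))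
    exact mem_iUnion₂.2 ⟨x, hx, hy, hyx⟩
  have h1 : ∫⁻ y in boundaryStrip Ω ε, ENNReal.ofReal (|w y| ^ p) ≤
      ∑ x ∈ t, C x * ENNReal.ofReal ε * I := by
    calc _ ≤ ∫⁻ y in ⋃ x ∈ t, boundaryStrip Ω ε ∩ Metric.ball x (r x), ENNReal.ofReal (|w y| ^ p) :=
          lintegral_mono_set hcov
      _ ≤ ∑ x ∈ t, ∫⁻ y in boundaryStrip Ω ε ∩ Metric.ball x (r x), ENNReal.ofReal (|w y| ^ p) := by
          rw [← Finset.sum_coe_sort, ← tsum_fintype (L := .unconditional _)]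
          refine le_trans (le_of_eq ?_) (lintegral_iUnion_le _ _)
          rw [iUnion_subtype]
      _ ≤ _ := Finset.sum_le_sum fun x hx => hC x (hts x hx) w hw ε hε
  rw [stripMeasure, lintegral_smul_measure, smul_eq_mul]
  calc _ ≤ ENNReal.ofReal (1 / ε) * ∑ x ∈ t, C x * ENNReal.ofReal ε * I := by gcongr
    _ = (ENNReal.ofReal (1 / ε) * ENNReal.ofReal ε) * ((∑ x ∈ t, (C x : ℝ≥0∞)) * I) := by
        rw [← Finset.sum_mul, ← Finset.sum_mul]; ring
    _ = _ := by
        rw [← ENNReal.ofReal_mul (by positivity), one_div, inv_mul_cancel₀ hε.ne',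
          ENNReal.ofReal_one, one_mul, ENNReal.ofNNReal_finsetSum]

/-! ### Mollification in `L^p` -/

section Mollify

variable {E : Type*} [NormedAddCommGroup E] [InnerProductSpace ℝ E] [FiniteDimensional ℝ E]
  [MeasurableSpace E] [BorelSpace E] {F : Type*} [NormedAddCommGroup F] [NormedSpace ℝ F]

-- This is continuity of the translation action on `L^p`, valid for finite `p`.
omit [NormedSpace ℝ F] in
theorem MeasureTheory.MemLp.tendsto_eLpNorm_translate_sub {p : ℝ≥0∞} (hp1 : 1 ≤ p) (hp : p ≠ ⊤)
    {f : E → F} (hf : MemLp f p) :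
    Tendsto (fun t : E => eLpNorm (fun x => f (x - t) - f x) p) (𝓝 0) (𝓝 0) := by
  have : Fact (1 ≤ p) := ⟨hp1⟩
  have : Fact (p ≠ ⊤) := ⟨hp⟩
  have hc : Continuous fun t : E => DomAddAct.mk (-t) +ᵥ hf.toLp f :=
    (DomAddAct.continuous_mk.comp continuous_neg).vadd continuous_const
  have h0 : DomAddAct.mk (-(0 : E)) +ᵥ hf.toLp f = hf.toLp f := by simp
  have h1 := (hc.tendsto 0).edist (tendsto_const_nhds (x := hf.toLp f))
  rw [h0, edist_self] at h1
  refine h1.congr fun t => ?_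
  rw [DomAddAct.mk_vadd_toLp, Lp.edist_toLp_toLp]
  congr 1
  ext x
  simp [sub_eq_neg_add]

/-- The average of the translates of `f` with weight `κ`. -/
noncomputable def mollify (κ : E → ℝ) (f : E → F) (x : E) : F := ∫ t, κ t • f (x - t)

theorem mollify_eq (κ : E → ℝ) (f : E → F) (x : E) : mollify κ f x = ∫ y, κ (x - y) • f y := by
  rw [mollify, ← integral_sub_left_eq_self (fun y => κ (x - y) • f y) volume x]
  simp

theorem integrable_smul_comp_sub {κ : E → ℝ} (hκ : Continuous κ) (hκs : HasCompactSupport κ)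
    {f : E → F} (hf : LocallyIntegrable f) (x : E) : Integrable fun t => κ t • f (x - t) := by
  have h1 : LocallyIntegrable fun t => f (x - t) := by
    rw [locallyIntegrable_iff]
    intro k hk
    have h2 := hf.integrableOn_isCompact (hk.image (f := fun t => x - t) (by fun_prop))
    have hmp : MeasurePreserving (fun t : E => x - t) := Measure.measurePreserving_sub_left volume x
    have hemb : MeasurableEmbedding fun t : E => x - t :=
      (MeasurableEquiv.subLeft x).measurableEmbedding
    have := (hmp.integrableOn_image hemb (f := f) (s := k)).1 h2
    exact this
  exact h1.integrable_smul_left_of_hasCompactSupport hκ hκs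

/-- Jensen for the probability measure `κ dt`, then Tonelli: the error is an average of translation
errors over the support of `κ`. -/
theorem eLpNorm_mollify_sub_le [CompleteSpace F] {p : ℝ≥0∞} (hp1 : 1 ≤ p) (hp : p ≠ ⊤) {κ : E → ℝ}
    (hκ : Continuous κ) (hκs : HasCompactSupport κ) (hκ0 : ∀ t, 0 ≤ κ t) (hκ1 : ∫ t, κ t = 1)
    {f : E → F} (hf : MemLp f p) {η : ℝ≥0∞}
    (hη : ∀ t ∈ tsupport κ, eLpNorm (fun x => f (x - t) - f x) p ≤ η) :
    eLpNorm (fun x => mollify κ f x - f x) p ≤ η := by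
  have hκi : Integrable κ := hκ.integrable_of_hasCompactSupport hκs
  set m : Measure E := volume.withDensity fun t => ENNReal.ofReal (κ t) with hm
  have hκm : Measurable fun t => ENNReal.ofReal (κ t) := hκ.measurable.ennreal_ofReal
  have hprob : IsProbabilityMeasure m := by
    refine ⟨?_⟩
    rw [hm, withDensity_apply _ MeasurableSet.univ, setLIntegral_univ,
      ← ofReal_integral_eq_lintegral_ofReal hκi (Eventually.of_forall hκ0), hκ1, ENNReal.ofReal_one]
  have hmac : m ≪ volume := withDensity_absolutelyContinuous _ _
  have hmsupp : ∀ᵐ t ∂m, t ∈ tsupport κ := by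
    rw [ae_withDensity_iff hκm]
    refine Eventually.of_forall fun t ht => subset_tsupport _ fun h0 => ht ?_
    rw [h0, ENNReal.ofReal_zero]
  have hsub : AEStronglyMeasurable (fun z : E × E => f (z.1 - z.2) - f z.1) (volume.prod m) := by
    refine AEStronglyMeasurable.sub ?_ ?_
    · exact hf.1.comp_quasiMeasurePreserving (quasiMeasurePreserving_sub_of_right_invariant volume m)
    · exact hf.1.comp_quasiMeasurePreserving Measure.quasiMeasurePreserving_fst
  set P := p.toReal with hP
  have hp0 : p ≠ 0 := (zero_lt_one.trans_le hp1).ne'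
  have hP0 : 0 < P := ENNReal.toReal_pos hp0 hp
  have hpow : ∀ (α : Type _) [MeasurableSpace α] (μ : Measure α) (g : α → F),
      eLpNorm g p μ ^ P = ∫⁻ x, ‖g x‖ₑ ^ P ∂μ := by
    intro α _ μ g
    rw [eLpNorm_eq_lintegral_rpow_enorm_toReal hp0 hp, ← ENNReal.rpow_mul, one_div,
      inv_mul_cancel₀ hP0.ne', ENNReal.rpow_one]
  have hfi : LocallyIntegrable f := hf.locallyIntegrable hp1
  have hpt : ∀ᵐ x, ‖mollify κ f x - f x‖ₑ ^ P ≤ ∫⁻ t, ‖f (x - t) - f x‖ₑ ^ P ∂m := by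
    filter_upwards [hsub.prodMk_left] with x hx
    have h1 : mollify κ f x - f x = ∫ t, κ t • (f (x - t) - f x) := by
      simp_rw [smul_sub]
      rw [integral_sub (integrable_smul_comp_sub hκ hκs hfi x) (hκi.smul_const _),
        integral_smul_const, hκ1, one_smul]
      rfl
    have h2 : ‖mollify κ f x - f x‖ₑ ≤ ∫⁻ t, ‖f (x - t) - f x‖ₑ ∂m := by
      rw [h1, hm, lintegral_withDensity_eq_lintegral_mul_non_measurable _ hκm
        (Eventually.of_forall fun t => ENNReal.ofReal_lt_top)]
      refine (enorm_integral_le_lintegral_enorm _).trans (lintegral_mono fun t => ?_)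
      rw [enorm_smul, Pi.mul_apply, Real.enorm_of_nonneg (hκ0 t)]
    -- Jensen, in the form that norms increase with the exponent on a probability space.
    have h3 := eLpNorm_le_eLpNorm_of_exponent_le hp1 hx
    rw [eLpNorm_one_eq_lintegral_enorm] at h3
    rw [← hpow]
    exact ENNReal.rpow_le_rpow (h2.trans h3) hP0.le
  rw [← ENNReal.rpow_le_rpow_iff hP0, hpow]
  calc _ ≤ ∫⁻ x, ∫⁻ t, ‖f (x - t) - f x‖ₑ ^ P ∂m := lintegral_mono_ae hpt
    _ = ∫⁻ t, (∫⁻ x, ‖f (x - t) - f x‖ₑ ^ P) ∂m :=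
        lintegral_lintegral_swap (hsub.enorm.pow_const P)
    _ ≤ ∫⁻ _, η ^ P ∂m := by
        refine lintegral_mono_ae (hmsupp.mono fun t ht => ?_)
        rw [← hpow]
        exact ENNReal.rpow_le_rpow (hη t ht) hP0.le
    _ = η ^ P := by simp

theorem mollify_eq_convolution (κ : E → ℝ) (f : E → ℝ) :
    mollify κ f = MeasureTheory.convolution f κ (ContinuousLinearMap.mul ℝ ℝ) volume := by
  ext x
  rw [mollify_eq, convolution_def]
  simp [mul_comm]

theorem contDiff_mollify {κ : E → ℝ} (hκ : ContDiff ℝ ∞ κ) (hκs : HasCompactSupport κ) {f : E → ℝ}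
    (hf : LocallyIntegrable f) : ContDiff ℝ ∞ (mollify κ f) := by
  rw [mollify_eq_convolution]
  exact hκs.contDiff_convolution_right _ hf hκ

theorem fderiv_mollify_apply {κ : E → ℝ} (hκ : ContDiff ℝ ∞ κ) (hκs : HasCompactSupport κ)
    {f : E → ℝ} (hf : LocallyIntegrable f) (x w : E) :
    fderiv ℝ (mollify κ f) x w = ∫ y, f y * fderiv ℝ κ (x - y) w := by
  have hκ1 : ContDiff ℝ 1 κ := hκ.of_le (by simp)
  rw [mollify_eq_convolution, (hκs.hasFDerivAt_convolution_right _ hf hκ1 x).fderiv,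
    convolution_precompR_apply _ hf (hκs.fderiv ℝ) (hκ1.continuous_fderiv one_ne_zero),
    convolution_def]
  simp

end Mollify

/-! ### Density of smooth functions in `W^{1,p}(Ω)` -/

section Density

variable {n : ℕ} {Ω : Set (EuclideanSpace ℝ (Fin n))} {u χ : EuclideanSpace ℝ (Fin n) → ℝ}
  {G : EuclideanSpace ℝ (Fin n) → EuclideanSpace ℝ (Fin n)}

theorem inner_gradient_eq_fderiv (v : EuclideanSpace ℝ (Fin n) → ℝ)
    (x w : EuclideanSpace ℝ (Fin n)) : ⟪gradient v x, w⟫_ℝ = fderiv ℝ v x w := by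
  simp [gradient]

theorem gradient_eq_zero_of_notMem_tsupport {x : EuclideanSpace ℝ (Fin n)}
    (hx : x ∉ tsupport χ) : gradient χ x = 0 := by
  have : fderiv ℝ χ x = 0 :=
    image_eq_zero_of_notMem_tsupport fun h => hx (tsupport_fderiv_subset ℝ h)
  rw [gradient, this, map_zero]

/-- The product rule for weak gradients, obtained by testing with `χ φ`. -/
theorem IsWeakGradient.integral_smul_mul_fderiv (h : IsWeakGradient Ω u G)
    (hu : IntegrableOn u Ω) (hG : IntegrableOn G Ω) (hχ : ContDiff ℝ ∞ χ)
    {φ : EuclideanSpace ℝ (Fin n) → ℝ} (hφ : ContDiff ℝ ∞ φ) (hφs : HasCompactSupport φ)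
    (hφΩ : tsupport φ ⊆ Ω) (w : EuclideanSpace ℝ (Fin n)) :
    ∫ x in Ω, (χ x * u x) * fderiv ℝ φ x w =
      -∫ x in Ω, ⟪χ x • G x + u x • gradient χ x, w⟫_ℝ * φ x := by
  have hχd := hχ.differentiable (by simp)
  have hφd := hφ.differentiable (by simp)
  have hprod : ∀ x, fderiv ℝ (fun x => χ x * φ x) x w
      = χ x * fderiv ℝ φ x w + φ x * fderiv ℝ χ x w := fun x => by
    rw [fderiv_fun_mul (hχd x) (hφd x)]; simp
  have hφ' : Continuous fun x => fderiv ℝ φ x w :=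
    (hφ.continuous_fderiv (by simp)).clm_apply continuous_const
  have hχ' : Continuous fun x => fderiv ℝ χ x w :=
    (hχ.continuous_fderiv (by simp)).clm_apply continuous_const
  have hint : ∀ {g k : EuclideanSpace ℝ (Fin n) → ℝ}, IntegrableOn g Ω → Continuous k →
      HasCompactSupport k → IntegrableOn (fun x => g x * k x) Ω := by
    intro g k hg hk hks
    obtain ⟨C, hC⟩ := hk.bounded_above_of_compact_support hks
    exact hg.mul_bdd hk.aestronglyMeasurable (Eventually.of_forall hC)
  have hφ's : HasCompactSupport fun x => fderiv ℝ φ x w := hφs.fderiv_apply ℝ w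
  have i1 : IntegrableOn (fun x => u x * (χ x * fderiv ℝ φ x w)) Ω :=
    hint hu (hχ.continuous.mul hφ') hφ's.mul_left
  have i2 : IntegrableOn (fun x => u x * (φ x * fderiv ℝ χ x w)) Ω :=
    hint hu (hφ.continuous.mul hχ') hφs.mul_right
  have i3 : IntegrableOn (fun x => ⟪G x, w⟫_ℝ * (χ x * φ x)) Ω :=
    hint (hG.inner_const w) (hχ.continuous.mul hφ.continuous) hφs.mul_left
  have key := h.2.2 (fun x => χ x * φ x) (hχ.mul hφ) hφs.mul_left
    ((tsupport_mul_subset_right).trans hφΩ) w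
  simp_rw [hprod, mul_add] at key
  rw [integral_add i1 i2] at key
  have e1 : ∀ x, (χ x * u x) * fderiv ℝ φ x w = u x * (χ x * fderiv ℝ φ x w) := fun x => by ring
  have e2 : ∀ x, ⟪χ x • G x + u x • gradient χ x, w⟫_ℝ * φ x
      = ⟪G x, w⟫_ℝ * (χ x * φ x) + u x * (φ x * fderiv ℝ χ x w) := fun x => by
    rw [inner_add_left, inner_smul_left, inner_smul_left, inner_gradient_eq_fderiv]
    simp only [conj_trivial]
    ring
  simp_rw [e1, e2]
  rw [integral_add i3 i2]
  linarith

theorem memLp_smul_add_smul_gradient {p : ℝ≥0∞} (hχ : ContDiff ℝ ∞ χ) (hχs : HasCompactSupport χ)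
    {μ : Measure (EuclideanSpace ℝ (Fin n))} (hu : MemLp u p μ) (hG : MemLp G p μ) :
    MemLp (fun x => χ x * u x) p μ ∧ MemLp (fun x => χ x • G x + u x • gradient χ x) p μ := by
  obtain ⟨C, hC⟩ := hχ.continuous.bounded_above_of_compact_support hχs
  have hgc : Continuous (gradient χ) := (hχ.of_le (by simp)).continuous_gradient
  have hgs : HasCompactSupport (gradient χ) :=
    hχs.mono' fun x hx => by
      by_contra h
      exact hx (gradient_eq_zero_of_notMem_tsupport h)
  obtain ⟨D, hD⟩ := hgc.bounded_above_of_compact_support hgs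
  have h1 : MemLp (fun x => χ x * u x) p μ := by
    refine hu.of_le_mul (c := C) (hχ.continuous.aestronglyMeasurable.mul hu.1)
      (Eventually.of_forall fun x => ?_)
    rw [norm_mul]
    exact mul_le_mul_of_nonneg_right (hC x) (norm_nonneg _)
  have h2 : MemLp (fun x => χ x • G x) p μ := by
    refine hG.of_le_mul (c := C) (hχ.continuous.aestronglyMeasurable.smul hG.1)
      (Eventually.of_forall fun x => ?_)
    rw [norm_smul]
    exact mul_le_mul_of_nonneg_right (hC x) (norm_nonneg _)
  have h3 : MemLp (fun x => u x • gradient χ x) p μ := by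
    refine hu.of_le_mul (c := D) (hu.1.smul hgc.aestronglyMeasurable)
      (Eventually.of_forall fun x => ?_)
    rw [norm_smul, mul_comm]
    exact mul_le_mul_of_nonneg_right (hD x) (norm_nonneg _)
  exact ⟨h1, h2.add h3⟩

/-- If the mollifier shifts inside `Ω`, the gradient of the mollified function is the mollified
weak gradient. -/
theorem IsWeakGradient.gradient_mollify_eq (h : IsWeakGradient Ω u G) (ho : IsOpen Ω)
    (hu : IntegrableOn u Ω) (hG : IntegrableOn G Ω) (hχ : ContDiff ℝ ∞ χ)
    {κ : EuclideanSpace ℝ (Fin n) → ℝ} (hκ : ContDiff ℝ ∞ κ) (hκs : HasCompactSupport κ)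
    (hU : LocallyIntegrable (Ω.indicator fun x => χ x * u x))
    (hV : LocallyIntegrable (Ω.indicator fun x => χ x • G x + u x • gradient χ x))
    {x : EuclideanSpace ℝ (Fin n)}
    (hx : (∀ t ∈ tsupport κ, x - t ∈ Ω) ∨ ∀ t ∈ tsupport κ, x - t ∉ tsupport χ) :
    gradient (mollify κ (Ω.indicator fun x => χ x * u x)) x =
      mollify κ (Ω.indicator fun x => χ x • G x + u x • gradient χ x) x := by
  refine ext_inner_right ℝ fun w => ?_
  rw [inner_gradient_eq_fderiv, fderiv_mollify_apply hκ hκs hU, real_inner_comm]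
  have hR : ⟪w, mollify κ (Ω.indicator fun x => χ x • G x + u x • gradient χ x) x⟫_ℝ
      = ∫ y, κ (x - y) * ⟪(Ω.indicator fun x => χ x • G x + u x • gradient χ x) y, w⟫_ℝ := by
    rw [mollify, ← integral_inner (integrable_smul_comp_sub hκ.continuous hκs hV x),
      ← integral_sub_left_eq_self (fun y => κ (x - y) *
        ⟪(Ω.indicator fun x => χ x • G x + u x • gradient χ x) y, w⟫_ℝ) volume x]
    refine integral_congr_ae (Eventually.of_forall fun t => ?_)
    simp only [inner_smul_right, sub_sub_cancel]
    rw [real_inner_comm]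
  rw [hR]
  -- In the first case `y ↦ κ (x - y)` is an admissible test function in `Ω`; in the second it
  -- vanishes on the support of `χ`, so both integrands are zero.
  rcases hx with hx | hx
  · set φ : EuclideanSpace ℝ (Fin n) → ℝ := fun y => κ (x - y) with hφ
    have hφc : ContDiff ℝ ∞ φ := hκ.comp (contDiff_const.sub contDiff_id)
    have hhom : tsupport φ = (fun y => x - y) ⁻¹' tsupport κ :=
      tsupport_comp_eq_preimage κ (Homeomorph.subLeft x)
    have hφs : HasCompactSupport φ := hκs.comp_homeomorph (Homeomorph.subLeft x)
    have hφΩ : tsupport φ ⊆ Ω := by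
      intro y hy
      rw [hhom] at hy
      simpa using hx _ hy
    have key := h.integral_smul_mul_fderiv hu hG hχ hφc hφs hφΩ w
    have hφd : ∀ y, fderiv ℝ φ y w = -fderiv ℝ κ (x - y) w := fun y => by
      have := ((hκ.differentiable (by simp)) (x - y)).hasFDerivAt.comp y
        ((hasFDerivAt_id y).const_sub x)
      have h2 : fderiv ℝ φ y = _ := this.fderiv
      rw [h2]
      simp
    have e1 : ∀ y, (Ω.indicator fun x => χ x * u x) y * fderiv ℝ κ (x - y) w
        = Ω.indicator (fun y => -((χ y * u y) * fderiv ℝ φ y w)) y := fun y => by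
      by_cases hy : y ∈ Ω
      · rw [indicator_of_mem hy, indicator_of_mem hy, hφd]; ring
      · rw [indicator_of_notMem hy, indicator_of_notMem hy, zero_mul]
    have e2 : ∀ y, κ (x - y) * ⟪(Ω.indicator fun x => χ x • G x + u x • gradient χ x) y, w⟫_ℝ
        = Ω.indicator (fun y => ⟪χ y • G y + u y • gradient χ y, w⟫_ℝ * φ y) y := fun y => by
      by_cases hy : y ∈ Ω
      · rw [indicator_of_mem hy, indicator_of_mem hy, mul_comm]
      · rw [indicator_of_notMem hy, indicator_of_notMem hy, inner_zero_left, mul_zero]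
    simp_rw [e1, e2]
    rw [integral_indicator ho.measurableSet, integral_indicator ho.measurableSet, integral_neg,
      key, neg_neg]
  · refine integral_congr_ae (Eventually.of_forall fun y => ?_)
    dsimp only
    by_cases hy : y ∈ tsupport χ
    · have hk : x - y ∉ tsupport κ := fun hk => hx _ hk (by simpa using hy)
      have h1 : fderiv ℝ κ (x - y) = 0 :=
        image_eq_zero_of_notMem_tsupport fun h => hk (tsupport_fderiv_subset ℝ h)
      rw [h1, image_eq_zero_of_notMem_tsupport hk]
      simp
    · have h1 : (Ω.indicator fun x => χ x * u x) y = 0 := by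
        rw [indicator_apply_eq_zero, image_eq_zero_of_notMem_tsupport hy, zero_mul]
        exact fun _ => rfl
      have h2 : (Ω.indicator fun x => χ x • G x + u x • gradient χ x) y = 0 := by
        rw [indicator_apply_eq_zero, image_eq_zero_of_notMem_tsupport hy,
          gradient_eq_zero_of_notMem_tsupport hy]
        simp
      rw [h1, h2]
      simp

/-- A centred mollifier would sample across the boundary. Shifting its support into the cone makes
it sample inside `Ω`, so the jump of the zero extension does not enter the gradient there. -/
theorem IsWeakGradient.exists_contDiff_approx_of_cone (h : IsWeakGradient Ω u G) (ho : IsOpen Ω)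
    (hb : Bornology.IsBounded Ω) {p : ℝ≥0∞} (hp1 : 1 ≤ p) (hp : p ≠ ⊤)
    (hu : MemLp u p (volume.restrict Ω)) (hG : MemLp G p (volume.restrict Ω))
    {x₀ : EuclideanSpace ℝ (Fin n)} {r : ℝ} (hcone : HasInteriorCone Ω x₀ r)
    (hχ : ContDiff ℝ ∞ χ) (hχr : tsupport χ ⊆ Metric.ball x₀ r) {η : ℝ≥0∞} (hη : 0 < η) :
    ∃ v : EuclideanSpace ℝ (Fin n) → ℝ, ContDiff ℝ 1 v ∧
      eLpNorm (fun x => v x - χ x * u x) p (volume.restrict Ω) ≤ η ∧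
      eLpNorm (fun x => gradient v x - (χ x • G x + u x • gradient χ x)) p
        (volume.restrict Ω) ≤ η := by
  obtain ⟨ν, c, τ₀, hc, hτ₀, hcone⟩ := hcone
  have hχs : HasCompactSupport χ := Metric.isCompact_of_isClosed_isBounded (isClosed_tsupport _)
    (Metric.isBounded_ball.subset hχr)
  have : IsFiniteMeasure (volume.restrict Ω) := ⟨by simpa using hb.measure_lt_top⟩
  obtain ⟨hU', hV'⟩ := memLp_smul_add_smul_gradient hχ hχs hu hG
  set U := Ω.indicator fun x => χ x * u x with hUdef
  set V := Ω.indicator fun x => χ x • G x + u x • gradient χ x with hVdef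
  have hU : MemLp U p := (memLp_indicator_iff_restrict ho.measurableSet).2 hU'
  have hV : MemLp V p := (memLp_indicator_iff_restrict ho.measurableSet).2 hV'
  obtain ⟨δ₁, hδ₁, hsub⟩ := hχs.isCompact.exists_thickening_subset_open Metric.isOpen_ball hχr
  have hev := (ENNReal.tendsto_nhds_zero.1 (hU.tendsto_eLpNorm_translate_sub hp1 hp) η hη).and
    (ENNReal.tendsto_nhds_zero.1 (hV.tendsto_eLpNorm_translate_sub hp1 hp) η hη)
  obtain ⟨δ₂, hδ₂, hball⟩ := Metric.eventually_nhds_iff.1 hev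
  set δ := min δ₁ δ₂
  have hδ : 0 < δ := lt_min hδ₁ hδ₂
  -- The support of the mollifier will lie within `τ (‖ν‖ + c) < δ` of the origin: small enough for
  -- both translation errors and to stay off the support of `χ` when `x` is outside the ball.
  obtain ⟨τ, hτ, hτ₁, hτ₂⟩ : ∃ τ > 0, τ ≤ τ₀ ∧ τ * (‖ν‖ + c) < δ := by
    refine ⟨min τ₀ (δ / 2 / (‖ν‖ + c)), lt_min hτ₀ (by positivity), min_le_left _ _, ?_⟩
    calc _ ≤ δ / 2 / (‖ν‖ + c) * (‖ν‖ + c) := by gcongr; exact min_le_right _ _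
      _ = δ / 2 := div_mul_cancel₀ _ (by positivity)
      _ < δ := by linarith
  -- Centred at `-τ ν` since `κ` samples at `x - t`; the outer radius `c τ / 2` keeps the samples in
  -- the cone ball around `x + τ ν`.
  let b : ContDiffBump (-(τ • ν)) := ⟨c * τ / 4, c * τ / 2, by positivity, by linarith [mul_pos hc hτ]⟩
  set κ := b.normed volume with hκdef
  have hκ : ContDiff ℝ ∞ κ := b.contDiff_normed
  have hκs : HasCompactSupport κ := b.hasCompactSupport_normed
  have hκt : ∀ t ∈ tsupport κ, ‖t + τ • ν‖ ≤ c * τ / 2 := by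
    intro t ht
    rw [hκdef, b.tsupport_normed_eq, Metric.mem_closedBall, dist_eq_norm, sub_neg_eq_add] at ht
    exact ht
  have hκδ : ∀ t ∈ tsupport κ, ‖t‖ < δ := by
    intro t ht
    have h1 := hκt t ht
    have h2 : ‖t‖ ≤ ‖t + τ • ν‖ + ‖τ • ν‖ := by
      simpa using norm_sub_le (t + τ • ν) (τ • ν)
    rw [norm_smul, Real.norm_of_nonneg hτ.le] at h2
    have := mul_pos hc hτ
    linarith
  have hgrad : ∀ x ∈ Ω, gradient (mollify κ U) x = mollify κ V x := by
    intro x hx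
    refine h.gradient_mollify_eq ho (hu.integrable hp1) (hG.integrable hp1) hχ hκ hκs
      (hU.locallyIntegrable hp1) (hV.locallyIntegrable hp1) ?_
    by_cases hxr : x ∈ Metric.ball x₀ r
    · left
      intro t ht
      refine hcone x ⟨hx, hxr⟩ τ hτ hτ₁ ?_
      rw [Metric.mem_ball, dist_eq_norm, show x - t - (x + τ • ν) = -(t + τ • ν) by abel, norm_neg]
      have := mul_pos hc hτ
      linarith [hκt t ht]
    · right
      intro t ht hmem
      refine hxr (hsub (Metric.mem_thickening_iff.2 ⟨x - t, hmem, ?_⟩))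
      rw [dist_eq_norm, sub_sub_cancel]
      exact (hκδ t ht).trans_le (min_le_left _ _)
  have hbound : ∀ t ∈ tsupport κ, eLpNorm (fun x => U (x - t) - U x) p ≤ η ∧
      eLpNorm (fun x => V (x - t) - V x) p ≤ η := fun t ht =>
    hball (by rw [dist_zero_right]; exact (hκδ t ht).trans_le (min_le_right _ _))
  refine ⟨mollify κ U, (contDiff_mollify hκ hκs (hU.locallyIntegrable hp1)).of_le (by simp), ?_, ?_⟩
  · have h1 := eLpNorm_mollify_sub_le hp1 hp hκ.continuous hκs b.nonneg_normed b.integral_normed hU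
      fun t ht => (hbound t ht).1
    refine le_trans (le_trans (le_of_eq ?_) (eLpNorm_restrict_le _ _ _ Ω)) h1
    refine eLpNorm_congr_ae ((ae_restrict_iff' ho.measurableSet).2 (Eventually.of_forall ?_))
    intro x hx
    simp only [hUdef, indicator_of_mem hx]
  · have h1 := eLpNorm_mollify_sub_le hp1 hp hκ.continuous hκs b.nonneg_normed b.integral_normed hV
      fun t ht => (hbound t ht).2
    refine le_trans (le_trans (le_of_eq ?_) (eLpNorm_restrict_le _ _ _ Ω)) h1
    refine eLpNorm_congr_ae ((ae_restrict_iff' ho.measurableSet).2 (Eventually.of_forall ?_))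
    intro x hx
    dsimp only
    rw [hgrad x hx, hVdef, indicator_of_mem hx]

end Density

open scoped Manifold in
/-- A finite smooth partition of unity subordinate to a family of balls around the points of a
compact set. -/
theorem IsCompact.exists_smooth_partition {n : ℕ} {K : Set (EuclideanSpace ℝ (Fin n))}
    (hK : IsCompact K) {r : EuclideanSpace ℝ (Fin n) → ℝ} (hr : ∀ x ∈ K, 0 < r x) :
    ∃ (t : Finset (EuclideanSpace ℝ (Fin n)))
      (χ : t → EuclideanSpace ℝ (Fin n) → ℝ), (∀ x ∈ t, x ∈ K) ∧ (∀ i, ContDiff ℝ ∞ (χ i)) ∧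
        (∀ i, tsupport (χ i) ⊆ Metric.ball (i : EuclideanSpace ℝ (Fin n)) (r i)) ∧
        (∀ i y, 0 ≤ χ i y) ∧ ∀ y ∈ K, ∑ i, χ i y = 1 := by
  obtain ⟨t, htK, htc⟩ := hK.elim_nhds_subcover (fun x => Metric.ball x (r x))
    fun x hx => Metric.ball_mem_nhds x (hr x hx)
  obtain ⟨f, hf⟩ := SmoothPartitionOfUnity.exists_isSubordinate 𝓘(ℝ, EuclideanSpace ℝ (Fin n))
    hK.isClosed (fun i : t => Metric.ball (i : EuclideanSpace ℝ (Fin n)) (r i))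
    (fun _ => Metric.isOpen_ball) (by rwa [iUnion_subtype])
  refine ⟨t, fun i => f i, htK, fun i => (f i).contMDiff.contDiff, hf, fun i y => f.nonneg i y,
    fun y hy => ?_⟩
  rw [← f.sum_eq_one hy, finsum_eq_sum_of_fintype]

/-- Functions of class `C¹` on the whole space are dense in `W^{1,p}(Ω)` if `Ω` is a bounded
Lipschitz domain. -/
theorem IsWeakGradient.exists_contDiff_approx {d : ℕ} {Ω : Set (EuclideanSpace ℝ (Fin (d + 1)))}
    {u : EuclideanSpace ℝ (Fin (d + 1)) → ℝ}
    {G : EuclideanSpace ℝ (Fin (d + 1)) → EuclideanSpace ℝ (Fin (d + 1))}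
    (h : IsWeakGradient Ω u G) (ho : IsOpen Ω) (hb : Bornology.IsBounded Ω)
    (hΩ : HasLipschitzBoundary Ω) {p : ℝ≥0∞} (hp1 : 1 ≤ p) (hp : p ≠ ⊤)
    (hu : MemLp u p (volume.restrict Ω)) (hG : MemLp G p (volume.restrict Ω)) {η : ℝ≥0∞}
    (hη : 0 < η) :
    ∃ v : EuclideanSpace ℝ (Fin (d + 1)) → ℝ, ContDiff ℝ 1 v ∧
      eLpNorm (fun x => v x - u x) p (volume.restrict Ω) ≤ η ∧
      eLpNorm (fun x => gradient v x - G x) p (volume.restrict Ω) ≤ η := by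
  have hloc : ∀ x ∈ closure Ω, ∃ r > 0, HasInteriorCone Ω x r := fun x hx =>
    hΩ.exists_hasInteriorCone ho hx
  choose! r hr hcone using hloc
  obtain ⟨t, χ, htK, hχ, hχs, -, hχ1⟩ := hb.isCompact_closure.exists_smooth_partition hr
  -- The `+ 1` covers an empty partition.
  have hN : η / (t.card + 1 : ℝ≥0∞) ≠ 0 := by
    simpa [ENNReal.div_eq_zero_iff] using hη.ne'
  have happrox : ∀ i : t, ∃ v : EuclideanSpace ℝ (Fin (d + 1)) → ℝ, ContDiff ℝ 1 v ∧
      eLpNorm (fun x => v x - χ i x * u x) p (volume.restrict Ω) ≤ η / (t.card + 1) ∧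
      eLpNorm (fun x => gradient v x - (χ i x • G x + u x • gradient (χ i) x)) p
        (volume.restrict Ω) ≤ η / (t.card + 1) := fun i =>
    h.exists_contDiff_approx_of_cone ho hb hp1 hp hu hG (hcone i (htK i i.2)) (hχ i) (hχs i)
      (pos_iff_ne_zero.2 hN)
  choose v hv hv1 hv2 using happrox
  have hcs : ∀ i, HasCompactSupport (χ i) := fun i =>
    Metric.isCompact_of_isClosed_isBounded (isClosed_tsupport _)
      (Metric.isBounded_ball.subset (hχs i))
  have hmem := fun i => memLp_smul_add_smul_gradient (hχ i) (hcs i) hu hG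
  have hvd : ∀ i x, DifferentiableAt ℝ (v i) x := fun i x => (hv i).differentiable one_ne_zero x
  have hχd : ∀ i x, DifferentiableAt ℝ (χ i) x := fun i x => (hχ i).differentiable (by simp) x
  have hgsum : ∀ (f : t → EuclideanSpace ℝ (Fin (d + 1)) → ℝ) x,
      (∀ i, DifferentiableAt ℝ (f i) x) →
      gradient (fun y => ∑ i, f i y) x = ∑ i, gradient (f i) x := by
    intro f x hf
    simp only [gradient]
    rw [fderiv_fun_sum fun i _ => hf i, map_sum]
  have hsumle : t.card * (η / (t.card + 1 : ℝ≥0∞)) ≤ η := by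
    calc _ ≤ (t.card + 1 : ℝ≥0∞) * (η / (t.card + 1 : ℝ≥0∞)) := by gcongr; exact le_self_add
      _ ≤ η := ENNReal.mul_div_le
  refine ⟨fun x => ∑ i, v i x, ContDiff.sum fun i _ => hv i, ?_, ?_⟩
  · calc eLpNorm (fun x => (∑ i, v i x) - u x) p (volume.restrict Ω)
        = eLpNorm (∑ i, fun x => v i x - χ i x * u x) p (volume.restrict Ω) := by
          refine eLpNorm_congr_ae ((ae_restrict_iff' ho.measurableSet).2 (Eventually.of_forall ?_))
          intro x hx
          simp only [Finset.sum_apply, Finset.sum_sub_distrib]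
          rw [← Finset.sum_mul, hχ1 x (subset_closure hx), one_mul]
      _ ≤ ∑ i, eLpNorm (fun x => v i x - χ i x * u x) p (volume.restrict Ω) :=
          eLpNorm_sum_le (fun i _ => (hv i).continuous.aestronglyMeasurable.sub (hmem i).1.1) hp1
      _ ≤ ∑ _i : t, η / (t.card + 1) := Finset.sum_le_sum fun i _ => hv1 i
      _ ≤ η := by simpa using hsumle
  · calc eLpNorm (fun x => gradient (fun x => ∑ i, v i x) x - G x) p (volume.restrict Ω)
        = eLpNorm (∑ i, fun x => gradient (v i) x - (χ i x • G x + u x • gradient (χ i) x)) p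
            (volume.restrict Ω) := by
          refine eLpNorm_congr_ae ((ae_restrict_iff' ho.measurableSet).2 (Eventually.of_forall ?_))
          intro x hx
          -- The cutoffs sum to `1` on a neighbourhood of `x`, so the terms with their gradients
          -- cancel.
          have h0 : ∑ i, gradient (χ i) x = 0 := by
            rw [← hgsum χ x fun i => hχd i x]
            have : (fun y => ∑ i, χ i y) =ᶠ[𝓝 x] fun _ => 1 := by
              filter_upwards [ho.mem_nhds hx] with y hy using hχ1 y (subset_closure hy)
            rw [gradient, this.fderiv_eq]
            simp
          simp only [Finset.sum_apply, Finset.sum_sub_distrib, Finset.sum_add_distrib]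
          rw [hgsum v x fun i => hvd i x, ← Finset.sum_smul, ← Finset.smul_sum,
            hχ1 x (subset_closure hx), h0]
          simp
      _ ≤ ∑ i, eLpNorm (fun x => gradient (v i) x - (χ i x • G x + u x • gradient (χ i) x)) p
            (volume.restrict Ω) :=
          eLpNorm_sum_le (fun i _ => (hv i).continuous_gradient.aestronglyMeasurable.sub
            (hmem i).2.1) hp1
      _ ≤ ∑ _i : t, η / (t.card + 1) := Finset.sum_le_sum fun i _ => hv2 i
      _ ≤ η := by simpa using hsumle

/-! ### Traces and the limit of the strip integrals -/

theorem frontier_nonempty_of_isBounded {E : Type*} [NormedAddCommGroup E] [NormedSpace ℝ E]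
    [Nontrivial E] {Ω : Set E} (hne : Ω.Nonempty) (hb : Bornology.IsBounded Ω) :
    (frontier Ω).Nonempty := by
  rw [nonempty_iff_ne_empty, Ne, frontier_eq_empty_iff]
  rintro (h | h)
  · exact hne.ne_empty h
  · exact NormedSpace.unbounded_univ ℝ E (h ▸ hb)

section

variable {d : ℕ} {Ω : Set (EuclideanSpace ℝ (Fin (d + 1)))}

theorem HasLipschitzBoundary.tendsto_lintegral_stripMeasure (hΩ : HasLipschitzBoundary Ω)
    (ho : IsOpen Ω) (hb : Bornology.IsBounded Ω) (hne : (frontier Ω).Nonempty)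
    {f : EuclideanSpace ℝ (Fin (d + 1)) → ℝ} (hf : Continuous f) (hf0 : ∀ y, 0 ≤ f y) :
    Tendsto (fun ε : ℝ => ∫⁻ y, ENNReal.ofReal (f y) ∂(stripMeasure Ω ε)) (𝓝[>] 0)
      (𝓝 (∫⁻ y, ENNReal.ofReal (f y) ∂(surfaceMeasure Ω))) := by
  have hloc := fun x (hx : x ∈ closure Ω) => hΩ.exists_tendsto_lintegral_stripMeasure ho hne hx
  choose! r hr hlim using hloc
  obtain ⟨t, χ, htK, hχ, hχs, hχ0, hχ1⟩ := hb.isCompact_closure.exists_smooth_partition hr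
  have hcont : ∀ i, Continuous fun y => χ i y * f y := fun i => (hχ i).continuous.mul hf
  have hsum : ∀ y ∈ closure Ω, ENNReal.ofReal (f y) = ∑ i, ENNReal.ofReal (χ i y * f y) := by
    intro y hy
    rw [← ENNReal.ofReal_sum_of_nonneg fun i _ => mul_nonneg (hχ0 i y) (hf0 y), ← Finset.sum_mul,
      hχ1 y hy, one_mul]
  have hdecomp : ∀ (μ : Measure (EuclideanSpace ℝ (Fin (d + 1)))), (∀ᵐ y ∂μ, y ∈ closure Ω) →
      ∫⁻ y, ENNReal.ofReal (f y) ∂μ = ∑ i, ∫⁻ y, ENNReal.ofReal (χ i y * f y) ∂μ := by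
    intro μ hμ
    rw [← lintegral_finsetSum _ fun i _ => (hcont i).measurable.ennreal_ofReal]
    exact lintegral_congr_ae (hμ.mono hsum)
  have h1 : ∀ ε, ∀ᵐ y ∂(stripMeasure Ω ε), y ∈ closure Ω := fun ε =>
    Measure.ae_smul_measure ((ae_restrict_mem (measurableSet_boundaryStrip ho ε)).mono
      fun y hy => subset_closure hy.1) _
  have h2 : ∀ᵐ y ∂(surfaceMeasure Ω), y ∈ closure Ω :=
    (ae_restrict_mem isClosed_frontier.measurableSet).mono fun y hy => frontier_subset_closure hy
  rw [hdecomp _ h2]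
  refine Tendsto.congr (fun ε => (hdecomp _ (h1 ε)).symm) ?_
  refine tendsto_finsetSum _ fun i _ => hlim i (htK i i.2) _ (hcont i) fun y hy => ?_
  rw [image_eq_zero_of_notMem_tsupport fun h => hy (hχs i h), zero_mul]

theorem eLpNorm_ofReal_rpow_eq {α F : Type*} [MeasurableSpace α] [NormedAddCommGroup F] {p : ℝ}
    (hp : 0 < p) (f : α → F) (μ : Measure α) :
    eLpNorm f (ENNReal.ofReal p) μ ^ p = ∫⁻ x, ENNReal.ofReal (‖f x‖ ^ p) ∂μ := by
  rw [eLpNorm_eq_lintegral_rpow_enorm_toReal (by simpa using hp) ENNReal.ofReal_ne_top,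
    ENNReal.toReal_ofReal hp.le, ← ENNReal.rpow_mul, one_div, inv_mul_cancel₀ hp.ne',
    ENNReal.rpow_one]
  refine lintegral_congr fun x => ?_
  rw [← ENNReal.ofReal_rpow_of_nonneg (norm_nonneg _) hp.le, ofReal_norm]

theorem HasLipschitzBoundary.tendsto_eLpNorm_stripMeasure (hΩ : HasLipschitzBoundary Ω)
    (ho : IsOpen Ω) (hb : Bornology.IsBounded Ω) (hne : (frontier Ω).Nonempty) {p : ℝ} (hp : 1 < p)
    {w : EuclideanSpace ℝ (Fin (d + 1)) → ℝ} (hw : Continuous w) :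
    Tendsto (fun ε : ℝ => eLpNorm w (ENNReal.ofReal p) (stripMeasure Ω ε)) (𝓝[>] 0)
      (𝓝 (eLpNorm w (ENNReal.ofReal p) (surfaceMeasure Ω))) := by
  have hp0 : 0 < p := by linarith
  have h := hΩ.tendsto_lintegral_stripMeasure ho hb hne (f := fun y => ‖w y‖ ^ p)
    (hw.norm.rpow_const fun _ => Or.inr hp0.le) fun y => by positivity
  simp_rw [← eLpNorm_ofReal_rpow_eq hp0] at h
  have h2 := (ENNReal.continuous_rpow_const (y := p⁻¹)).tendsto _ |>.comp h
  simpa [Function.comp_def, ← ENNReal.rpow_mul, mul_inv_cancel₀ hp0.ne'] using h2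

/-- The strip norms and the boundary norm of a `C¹` function are bounded by its Sobolev norm. -/
theorem HasLipschitzBoundary.exists_eLpNorm_le (hΩ : HasLipschitzBoundary Ω)
    (ho : IsOpen Ω) (hb : Bornology.IsBounded Ω) (hne : (frontier Ω).Nonempty) {p : ℝ}
    (hp : 1 < p) :
    ∃ C : ℝ≥0∞, C ≠ ⊤ ∧ ∀ w : EuclideanSpace ℝ (Fin (d + 1)) → ℝ, ContDiff ℝ 1 w →
      (∀ ε > 0, eLpNorm w (ENNReal.ofReal p) (stripMeasure Ω ε) ≤
        C * (eLpNorm w (ENNReal.ofReal p) (volume.restrict Ω) +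
          eLpNorm (gradient w) (ENNReal.ofReal p) (volume.restrict Ω))) ∧
      eLpNorm w (ENNReal.ofReal p) (surfaceMeasure Ω) ≤
        C * (eLpNorm w (ENNReal.ofReal p) (volume.restrict Ω) +
          eLpNorm (gradient w) (ENNReal.ofReal p) (volume.restrict Ω)) := by
  have hp0 : 0 < p := by linarith
  obtain ⟨C, hC⟩ := hΩ.exists_lintegral_stripMeasure_le ho hb hne hp
  have hstrip : ∀ w : EuclideanSpace ℝ (Fin (d + 1)) → ℝ, ContDiff ℝ 1 w → ∀ ε > 0,
      eLpNorm w (ENNReal.ofReal p) (stripMeasure Ω ε) ≤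
        (C : ℝ≥0∞) ^ p⁻¹ * (eLpNorm w (ENNReal.ofReal p) (volume.restrict Ω) +
          eLpNorm (gradient w) (ENNReal.ofReal p) (volume.restrict Ω)) := by
    intro w hw ε hε
    rw [← ENNReal.rpow_le_rpow_iff hp0, ENNReal.mul_rpow_of_nonneg _ _ hp0.le, ← ENNReal.rpow_mul,
      inv_mul_cancel₀ hp0.ne', ENNReal.rpow_one, eLpNorm_ofReal_rpow_eq hp0]
    refine (hC w hw ε hε).trans ?_
    gcongr
    refine le_trans (le_of_eq ?_) (ENNReal.add_rpow_le_rpow_add _ _ hp.le)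
    rw [eLpNorm_ofReal_rpow_eq hp0, eLpNorm_ofReal_rpow_eq hp0, ← lintegral_add_left]
    · refine lintegral_congr fun z => ?_
      rw [← ENNReal.ofReal_add (by positivity) (by positivity)]
      rfl
    · exact (hw.continuous.norm.rpow_const fun _ => Or.inr hp0.le).measurable.ennreal_ofReal
  refine ⟨(C : ℝ≥0∞) ^ p⁻¹, ENNReal.rpow_ne_top_of_nonneg (by positivity) ENNReal.coe_ne_top,
    fun w hw => ⟨hstrip w hw, ?_⟩⟩
  refine le_of_tendsto (hΩ.tendsto_eLpNorm_stripMeasure ho hb hne hp hw.continuous) ?_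
  filter_upwards [self_mem_nhdsWithin] with ε hε using hstrip w hw ε hε

/-- The uniform strip bound for the constant `1` passes to the limit; the exponent `2` is arbitrary.
-/
theorem HasLipschitzBoundary.isFiniteMeasure_surfaceMeasure (hΩ : HasLipschitzBoundary Ω)
    (ho : IsOpen Ω) (hb : Bornology.IsBounded Ω) (hne : (frontier Ω).Nonempty) :
    IsFiniteMeasure (surfaceMeasure Ω) := by
  obtain ⟨C, hC⟩ := hΩ.exists_lintegral_stripMeasure_le ho hb hne one_lt_two
  have h := hΩ.tendsto_lintegral_stripMeasure ho hb hne (f := fun _ => 1) continuous_const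
    fun _ => zero_le_one
  have h2 : ∫⁻ _, ENNReal.ofReal 1 ∂(surfaceMeasure Ω) ≤ C * volume Ω := by
    refine le_of_tendsto h ?_
    filter_upwards [self_mem_nhdsWithin] with ε hε
    have := hC (fun _ => 1) contDiff_const ε hε
    simpa [energyDensity, gradient] using this
  rw [ENNReal.ofReal_one, lintegral_one] at h2
  exact ⟨h2.trans_lt (ENNReal.mul_lt_top ENNReal.coe_lt_top hb.measure_lt_top)⟩

theorem gradient_sub_of_contDiff {v w : EuclideanSpace ℝ (Fin (d + 1)) → ℝ} (hv : ContDiff ℝ 1 v)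
    (hw : ContDiff ℝ 1 w) :
    gradient (fun x => v x - w x) = fun x => gradient v x - gradient w x := by
  ext1 x
  simp only [gradient]
  rw [fderiv_fun_sub (hv.differentiable one_ne_zero x) (hw.differentiable one_ne_zero x), map_sub]

theorem eLpNorm_sub_le_add {α F : Type*} [MeasurableSpace α] [NormedAddCommGroup F]
    {μ : Measure α} {p : ℝ≥0∞} (hp : 1 ≤ p) {f g h : α → F} (hf : AEStronglyMeasurable f μ)
    (hg : AEStronglyMeasurable g μ) (hh : AEStronglyMeasurable h μ) :
    eLpNorm (fun x => f x - g x) p μ ≤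
      eLpNorm (fun x => f x - h x) p μ + eLpNorm (fun x => g x - h x) p μ := by
  have := eLpNorm_sub_le (hf.sub hh) (hg.sub hh) hp
  simpa [sub_sub_sub_cancel_right, Pi.sub_def] using this

/-- The trace inequality makes the boundary values of approximants Cauchy in `L^p(∂Ω)`; geometric
errors give the summability needed for completeness. -/
theorem MemSobolevOne.exists_isTrace (hΩ : HasLipschitzBoundary Ω)
    (ho : IsOpen Ω) (hb : Bornology.IsBounded Ω) (hne : (frontier Ω).Nonempty) {p : ℝ}
    (hp : 1 < p) {u : EuclideanSpace ℝ (Fin (d + 1)) → ℝ}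
    (hu : MemSobolevOne Ω (ENNReal.ofReal p) u) : ∃ g, IsTrace Ω (ENNReal.ofReal p) u g := by
  obtain ⟨hum, G, hwg, hG⟩ := id hu
  have hp1 : 1 ≤ ENNReal.ofReal p := by simpa using hp.le
  have hfin := hΩ.isFiniteMeasure_surfaceMeasure ho hb hne
  obtain ⟨C, hCtop, hC⟩ := hΩ.exists_eLpNorm_le ho hb hne hp
  have hη : ∀ k : ℕ, (0 : ℝ≥0∞) < 2⁻¹ ^ k := fun k => ENNReal.pow_pos (by simp) k
  choose v hv hv1 hv2 using fun k : ℕ =>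
    hwg.exists_contDiff_approx ho hb hΩ hp1 ENNReal.ofReal_ne_top hum hG (hη k)
  have hpow0 : Tendsto (fun k : ℕ => (2⁻¹ : ℝ≥0∞) ^ k) atTop (𝓝 0) :=
    ENNReal.tendsto_pow_atTop_nhds_zero_of_lt_one (by simp)
  have hmem : ∀ k, MemLp (v k) (ENNReal.ofReal p) (surfaceMeasure Ω) := by
    intro k
    have hcomp : IsCompact (frontier Ω) :=
      hb.isCompact_closure.of_isClosed_subset isClosed_frontier frontier_subset_closure
    obtain ⟨M, hM⟩ := hcomp.exists_bound_of_continuousOn (hv k).continuous.continuousOn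
    exact MemLp.of_bound (hv k).continuous.aestronglyMeasurable M
      ((ae_restrict_mem isClosed_frontier.measurableSet).mono hM)
  -- Four errors of size at most `2⁻¹ ^ N` enter, two for values and two for gradients; the extra `+
  -- 1` makes the inequality strict.
  have hcau : ∀ N n m : ℕ, N ≤ n → N ≤ m →
      eLpNorm (v n - v m) (ENNReal.ofReal p) (surfaceMeasure Ω) < (C * 4 + 1) * 2⁻¹ ^ N := by
    intro N n m hn hm
    have hmono : ∀ k, N ≤ k → (2⁻¹ : ℝ≥0∞) ^ k ≤ 2⁻¹ ^ N := fun k hk =>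
      pow_le_pow_right_of_le_one' (by simp) hk
    have h1 := (hC (fun x => v n x - v m x) ((hv n).sub (hv m))).2
    rw [gradient_sub_of_contDiff (hv n) (hv m)] at h1
    have h2 := (eLpNorm_sub_le_add hp1 (hv n).continuous.aestronglyMeasurable
      (hv m).continuous.aestronglyMeasurable hum.1).trans
      (add_le_add ((hv1 n).trans (hmono n hn)) ((hv1 m).trans (hmono m hm)))
    have h3 := (eLpNorm_sub_le_add hp1 (hv n).continuous_gradient.aestronglyMeasurable
      (hv m).continuous_gradient.aestronglyMeasurable hG.1).trans
      (add_le_add ((hv2 n).trans (hmono n hn)) ((hv2 m).trans (hmono m hm)))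
    have h4 : eLpNorm (v n - v m) (ENNReal.ofReal p) (surfaceMeasure Ω) ≤ C * 4 * 2⁻¹ ^ N := by
      refine (h1.trans (mul_le_mul_right (add_le_add h2 h3) C)).trans (le_of_eq ?_)
      ring
    refine h4.trans_lt ?_
    rw [add_mul, one_mul]
    refine ENNReal.lt_add_right (ENNReal.mul_ne_top (ENNReal.mul_ne_top hCtop (by simp)) ?_)
      (hη N).ne'
    exact ENNReal.pow_ne_top (by simp)
  have hB : ∑' N : ℕ, (C * 4 + 1) * (2⁻¹ : ℝ≥0∞) ^ N ≠ ⊤ := by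
    rw [ENNReal.tsum_mul_left, ENNReal.tsum_geometric]
    refine ENNReal.mul_ne_top (ENNReal.add_ne_top.2 ⟨ENNReal.mul_ne_top hCtop (by simp), by simp⟩) ?_
    simp
  obtain ⟨g, hg, hglim⟩ := Lp.cauchy_complete_eLpNorm hp1 hmem hB hcau
  exact ⟨g, hu, hg, G, hwg, v, hv,
    tendsto_of_tendsto_of_tendsto_of_le_of_le tendsto_const_nhds hpow0 (fun _ => zero_le) hv1,
    tendsto_of_tendsto_of_tendsto_of_le_of_le tendsto_const_nhds hpow0 (fun _ => zero_le) hv2,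
    hglim⟩

/-- Interchange of limits: the error `c k` does not depend on `a`, so the lower and upper limits of
`F` are both within `c k + e k` of `L`. -/
theorem ENNReal.tendsto_of_uniform_approx {α : Type*} {l : Filter α} {F : α → ℝ≥0∞}
    {Fk : ℕ → α → ℝ≥0∞} {L : ℝ≥0∞} {Lk c e : ℕ → ℝ≥0∞} (hFk : ∀ k, Tendsto (Fk k) l (𝓝 (Lk k)))
    (h1 : ∀ k, ∀ᶠ a in l, F a ≤ Fk k a + c k) (h2 : ∀ k, ∀ᶠ a in l, Fk k a ≤ F a + c k)
    (h3 : ∀ k, L ≤ Lk k + e k) (h4 : ∀ k, Lk k ≤ L + e k) (hc : Tendsto c atTop (𝓝 0))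
    (he : Tendsto e atTop (𝓝 0)) : Tendsto F l (𝓝 L) := by
  rcases l.eq_or_neBot with rfl | hl
  · exact tendsto_bot
  have hce := hc.add he
  rw [add_zero] at hce
  refine tendsto_of_le_liminf_of_limsup_le ?_ ?_
  · have hk : ∀ k, L ≤ liminf F l + (c k + e k) := by
      intro k
      by_cases hck : c k = ⊤
      · simp [hck]
      have h5 : Tendsto (fun a => Fk k a - c k) l (𝓝 (Lk k - c k)) :=
        ENNReal.Tendsto.sub (hFk k) tendsto_const_nhds (Or.inr hck)
      have h6 : Lk k - c k ≤ liminf F l := by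
        rw [← h5.liminf_eq]
        exact liminf_le_liminf ((h2 k).mono fun a ha => tsub_le_iff_right.2 ha)
      calc L ≤ Lk k + e k := h3 k
        _ ≤ (liminf F l + c k) + e k := by gcongr; exact tsub_le_iff_right.1 h6
        _ = _ := add_assoc _ _ _
    have := tendsto_const_nhds (x := liminf F l) |>.add hce
    rw [add_zero] at this
    exact ge_of_tendsto' this hk
  · have hk : ∀ k, limsup F l ≤ L + (c k + e k) := by
      intro k
      have h5 : Tendsto (fun a => Fk k a + c k) l (𝓝 (Lk k + c k)) :=
        (hFk k).add tendsto_const_nhds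
      calc limsup F l ≤ limsup (fun a => Fk k a + c k) l := limsup_le_limsup (h1 k)
        _ = Lk k + c k := h5.limsup_eq
        _ ≤ (L + e k) + c k := by gcongr; exact h4 k
        _ = _ := by ring
    have := tendsto_const_nhds (x := L) |>.add hce
    rw [add_zero] at this
    exact ge_of_tendsto' this hk

theorem stripMeasure_le (Ω : Set (EuclideanSpace ℝ (Fin (d + 1)))) (ε : ℝ) :
    stripMeasure Ω ε ≤ ENNReal.ofReal (1 / ε) • volume.restrict Ω := by
  unfold stripMeasure
  gcongr
  exact fun y hy => hy.1

theorem stripMeasure_absolutelyContinuous (Ω : Set (EuclideanSpace ℝ (Fin (d + 1)))) (ε : ℝ) :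
    stripMeasure Ω ε ≪ volume.restrict Ω :=
  (Measure.absolutelyContinuous_of_le (stripMeasure_le Ω ε)).trans
    (Measure.smul_absolutelyContinuous)

theorem IsTrace.tendsto_eLpNorm_stripMeasure (hΩ : HasLipschitzBoundary Ω)
    (ho : IsOpen Ω) (hb : Bornology.IsBounded Ω) (hne : (frontier Ω).Nonempty) {p : ℝ}
    (hp : 1 < p) {u g : EuclideanSpace ℝ (Fin (d + 1)) → ℝ}
    (h : IsTrace Ω (ENNReal.ofReal p) u g) :
    Tendsto (fun ε : ℝ => eLpNorm u (ENNReal.ofReal p) (stripMeasure Ω ε)) (𝓝[>] 0)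
      (𝓝 (eLpNorm g (ENNReal.ofReal p) (surfaceMeasure Ω))) := by
  obtain ⟨⟨hum, -⟩, hg, G, hwg, v, hv, hv1, hv2, hvg⟩ := h
  have hp1 : 1 ≤ ENNReal.ofReal p := by simpa using hp.le
  obtain ⟨C, hCtop, hC⟩ := hΩ.exists_eLpNorm_le ho hb hne hp
  have hGm : AEStronglyMeasurable G (volume.restrict Ω) := hwg.2.1.aestronglyMeasurable
  set P := ENNReal.ofReal p
  set a : ℕ → ℝ≥0∞ := fun k => eLpNorm (fun x => v k x - u x) P (volume.restrict Ω)
  set b : ℕ → ℝ≥0∞ := fun k => eLpNorm (fun x => gradient (v k) x - G x) P (volume.restrict Ω)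
  have hus : ∀ ε, AEStronglyMeasurable u (stripMeasure Ω ε) := fun ε =>
    hum.1.mono_ac (stripMeasure_absolutelyContinuous Ω ε)
  have hvm : ∀ k (μ : Measure (EuclideanSpace ℝ (Fin (d + 1)))), AEStronglyMeasurable (v k) μ :=
    fun k μ => (hv k).continuous.aestronglyMeasurable
  have hkey : ∀ k, ∀ ε > 0, eLpNorm (fun x => v k x - u x) P (stripMeasure Ω ε)
      ≤ C * (a k + b k) := by
    intro k ε hε
    -- The uniform bound needs `C¹` functions, so it is applied to `v k - v j`. The remainder `v j -
    -- u` carries a factor that blows up with `1 / ε`, but it vanishes as `j → ∞` for fixed `ε`.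
    have hj : ∀ j, eLpNorm (fun x => v k x - u x) P (stripMeasure Ω ε) ≤
        C * ((a k + a j) + (b k + b j)) + ENNReal.ofReal (1 / ε) ^ (1 / P).toReal * a j := by
      intro j
      have h1 : eLpNorm (fun x => v k x - v j x) P (stripMeasure Ω ε) ≤
          C * ((a k + a j) + (b k + b j)) := by
        refine ((hC (fun x => v k x - v j x) ((hv k).sub (hv j))).1 ε hε).trans ?_
        rw [gradient_sub_of_contDiff (hv k) (hv j)]
        gcongr
        · exact eLpNorm_sub_le_add hp1 (hvm k _) (hvm j _) hum.1
        · exact eLpNorm_sub_le_add hp1 (hv k).continuous_gradient.aestronglyMeasurable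
            (hv j).continuous_gradient.aestronglyMeasurable hGm
      have h2 : eLpNorm (fun x => v j x - u x) P (stripMeasure Ω ε) ≤
          ENNReal.ofReal (1 / ε) ^ (1 / P).toReal * a j := by
        refine (eLpNorm_mono_measure _ (stripMeasure_le Ω ε)).trans ?_
        rw [eLpNorm_smul_measure_of_ne_top ENNReal.ofReal_ne_top, smul_eq_mul]
      refine (eLpNorm_sub_le_add hp1 (hvm k _) (hus ε) (hvm j _)).trans (add_le_add h1 ?_)
      exact (eLpNorm_sub_comm u (v j) P _).trans_le h2
    have hlim : Tendsto (fun j => C * ((a k + a j) + (b k + b j)) +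
        ENNReal.ofReal (1 / ε) ^ (1 / P).toReal * a j) atTop
        (𝓝 (C * ((a k + 0) + (b k + 0)) + ENNReal.ofReal (1 / ε) ^ (1 / P).toReal * 0)) := by
      refine Tendsto.add ?_ ?_
      · exact ENNReal.Tendsto.const_mul ((tendsto_const_nhds.add hv1).add
          (tendsto_const_nhds.add hv2)) (Or.inr hCtop)
      · refine ENNReal.Tendsto.const_mul hv1 (Or.inr ?_)
        exact ENNReal.rpow_ne_top_of_nonneg (by positivity) ENNReal.ofReal_ne_top
    have := ge_of_tendsto' hlim hj
    simpa using this
  have hcomp : ∀ {f₁ f₂ : EuclideanSpace ℝ (Fin (d + 1)) → ℝ}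
      {μ : Measure (EuclideanSpace ℝ (Fin (d + 1)))}, AEStronglyMeasurable f₁ μ →
      AEStronglyMeasurable f₂ μ → eLpNorm f₁ P μ ≤ eLpNorm f₂ P μ +
        eLpNorm (fun x => f₁ x - f₂ x) P μ := by
    intro f₁ f₂ μ h₁ h₂
    have := eLpNorm_add_le h₂ (h₁.sub h₂) hp1
    rwa [add_sub_cancel] at this
  have hsw : ∀ {f₁ f₂ : EuclideanSpace ℝ (Fin (d + 1)) → ℝ}
      {μ : Measure (EuclideanSpace ℝ (Fin (d + 1)))},
      eLpNorm (fun x => f₁ x - f₂ x) P μ = eLpNorm (fun x => f₂ x - f₁ x) P μ := by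
    intro f₁ f₂ μ
    exact eLpNorm_sub_comm f₁ f₂ P μ
  refine ENNReal.tendsto_of_uniform_approx
    (c := fun k => C * (a k + b k))
    (e := fun k => eLpNorm (fun x => v k x - g x) P (surfaceMeasure Ω))
    (fun k => hΩ.tendsto_eLpNorm_stripMeasure ho hb hne hp (hv k).continuous) ?_ ?_ ?_ ?_ ?_ hvg
  · intro k
    filter_upwards [self_mem_nhdsWithin] with ε hε
    refine (hcomp (hus ε) (hvm k _)).trans ?_
    rw [hsw]
    gcongr
    exact hkey k ε hε
  · intro k
    filter_upwards [self_mem_nhdsWithin] with ε hε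
    refine (hcomp (hvm k _) (hus ε)).trans ?_
    gcongr
    exact hkey k ε hε
  · intro k
    refine (hcomp hg.1 (hvm k _)).trans_eq ?_
    rw [hsw]
  · intro k
    exact hcomp (hvm k _) hg.1
  · have := ENNReal.Tendsto.const_mul (a := C) (hv1.add hv2) (Or.inr hCtop)
    simpa using this

end

theorem mainTheorem3 {n : ℕ} (hn : 1 ≤ n) (Ω : Set (EuclideanSpace ℝ (Fin n)))
    (hΩ_open : IsOpen Ω) (hΩ_conn : IsConnected Ω) (hΩ_bdd : Bornology.IsBounded Ω)
    (hΩ_lip : HasLipschitzBoundary Ω) (p : ℝ) (hp : 1 < p)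
    (u : EuclideanSpace ℝ (Fin n) → ℝ) (hu : MemSobolevOne Ω (ENNReal.ofReal p) u) :
    (∃ g, IsTrace Ω (ENNReal.ofReal p) u g) ∧
    ∀ g, IsTrace Ω (ENNReal.ofReal p) u g →
      Tendsto (fun ε : ℝ => (1 / ε) * ∫ x in boundaryStrip Ω ε, |u x| ^ p) (𝓝[>] 0)
        (𝓝 (∫ x, |g x| ^ p ∂(surfaceMeasure Ω))) := by
  obtain ⟨d, rfl⟩ : ∃ d, n = d + 1 := ⟨n - 1, by omega⟩
  -- The distance to an empty set is `0` by convention, so with an empty frontier the strip would be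
  -- all of `Ω`.
  have hne := frontier_nonempty_of_isBounded hΩ_conn.nonempty hΩ_bdd
  refine ⟨hu.exists_isTrace hΩ_lip hΩ_open hΩ_bdd hne hp, fun g hg => ?_⟩
  have hp0 : 0 < p := by linarith
  have hlim := hg.tendsto_eLpNorm_stripMeasure hΩ_lip hΩ_open hΩ_bdd hne hp
  have hpow := (ENNReal.continuous_rpow_const (y := p)).tendsto _ |>.comp hlim
  -- Finiteness of the limit makes `toReal` continuous there, so convergence transfers to real
  -- integrals.
  have hfin : eLpNorm g (ENNReal.ofReal p) (surfaceMeasure Ω) ^ p ≠ ⊤ :=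
    ENNReal.rpow_ne_top_of_nonneg hp0.le hg.2.1.2.ne
  have hconv : ∀ (f : EuclideanSpace ℝ (Fin (d + 1)) → ℝ)
      (μ : Measure (EuclideanSpace ℝ (Fin (d + 1)))), AEStronglyMeasurable f μ →
      ∫ x, |f x| ^ p ∂μ = (eLpNorm f (ENNReal.ofReal p) μ ^ p).toReal := by
    intro f μ hf
    simp_rw [eLpNorm_ofReal_rpow_eq hp0, Real.norm_eq_abs]
    exact integral_eq_lintegral_of_nonneg_ae (f := fun x => |f x| ^ p)
      (Eventually.of_forall fun x => by positivity)
      (hf.aemeasurable.norm.pow_const p).aestronglyMeasurable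
  rw [hconv g _ hg.2.1.1]
  refine ((ENNReal.tendsto_toReal hfin).comp hpow).congr' ?_
  filter_upwards [self_mem_nhdsWithin] with ε hε
  have hε0 : 0 ≤ 1 / ε := one_div_nonneg.2 (le_of_lt hε)
  have h1 := hconv u (stripMeasure Ω ε)
    (hu.1.1.mono_ac (stripMeasure_absolutelyContinuous Ω ε))
  rw [stripMeasure, integral_smul_measure, ENNReal.toReal_ofReal hε0, smul_eq_mul] at h1
  exact h1.symm
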